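/- Let $(X_t,(\mathbb P_x)_{x\in E})$ be a conservative continuous-time Markov process (jointly measurable in time and randomness) on a Polish space $E$, with semigroup $P_tf(x)=\mathbb E_x[f(X_t)]$ and an invariant probability measure $\mu$; write $\mathbb P_\mu=\int\mathbb P_x\,\mu(dx)$ and $[t]$ for the integer part of $t$. Say that $\mu$ satisfies the decay property with a non-increasing function $\eta:[0,\infty)\to\mathbb R$ if $$\mathrm{Var}_\mu(P_tf)\le \eta(t)\,\Big\|f-\int f\,d\mu\Big\|_\infty^2\qquad\text{for all bounded measurable } f \text{ and all } t\ge 0 .$$ The associated rate is $\alpha(r)=\sqrt{\eta(r)}$; if $(P_t)$ is symmetric with respect to $\mu$, one may also take $\alpha(r)=\eta(r/2)$. For every $c>0$ there exists a constant $k_0>0$, depending only on $c$, such that the following holds. Let $0<p\le 1$ and $c'>0$, and suppose that the decay property holds with some $\eta$ whose associated rate is $\alpha(s)=c\,e^{-c's^{p/(2-p)}}$, $s\ge0$. Then for every measurable $V:E\to\mathbb R$ with $\sup|V|=1$, every $0<R\le1$ and every $t>0$ with $t(1-R)<[t]$, $$\mathbb P_\mu\left(\frac1t\int_0^tV(X_s)\,ds-\int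 V\,d\mu\ \ge\ R\right)\ \le\ \exp\left\{-c(p)\left(\Big(R-\Big(1-\frac{[t]}t\Big)\Big)\sqrt t\right)^p\right\},$$ where $$c(p)=\frac{2-p}{p}\left(\frac12\right)^p\left(\frac{p\,c'}{2-p}\right)^{(2-p)/2},$$ provided that $$\Big(R-\Big(1-\frac{[t]}t\Big)\Big)\sqrt t\ \ge\ 2\,k_0^{1/p}\left(\frac{2-p}{p\,c'}\right)^{(2-p)/(2p)} .$$ -/

import Mathlib

open MeasureTheory ProbabilityTheory
open scoped NNReal ENNReal

/-- A conservative continuous-time (time-homogeneous) Markov process with state space `E`: a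
measurable family `(ℙ_x)` of probability measures on `Ω` and a jointly measurable process
`(X_t)_{t ≥ 0}` with values in `E`. Conservativeness is built in: the process lives in `E` at all
times and each `ℙ_x` has mass one. -/
structure MarkovProcess (E Ω : Type*) [MeasurableSpace E] [MeasurableSpace Ω] where
  /-- `Pr x` is the law `ℙ_x` of the process started at `x`. -/
  Pr : Kernel E Ω
  isMarkovKernel : IsMarkovKernel Pr
  /-- The process. -/
  X : ℝ≥0 → Ω → E
  /-- Joint measurability in time and randomness, so that `∫₀ᵗ V(X_s) ds` makes sense. -/
  measurable_X : Measurable (Function.uncurry X)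
  start : ∀ x, ∀ᵐ ω ∂(Pr x), X 0 ω = x
  /-- The Markov property: conditionally on `σ(X_u, u ≤ s)`, the probability under `ℙ_x` that
  `X_{s+t} ∈ B` is `ℙ_{X_s}(X_t ∈ B)`. -/
  markov : ∀ (x : E) (s t : ℝ≥0) (A : Set Ω),
    MeasurableSet[⨆ u : Set.Iic s, MeasurableSpace.comap (X u) inferInstance] A →
    ∀ B : Set E, MeasurableSet B →
      Pr x (A ∩ X (s + t) ⁻¹' B) = ∫⁻ ω in A, Pr (X s ω) (X t ⁻¹' B) ∂(Pr x)

namespace MarkovProcess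

variable {E Ω : Type*} [MeasurableSpace E] [MeasurableSpace Ω]

/-- The transition kernel `P_t(x, B) = ℙ_x(X_t ∈ B)`. -/
noncomputable def transition (M : MarkovProcess E Ω) (t : ℝ≥0) : Kernel E E :=
  M.Pr.map (M.X t)

/-- The semigroup acting on functions: `(P_t f)(x) = 𝔼_x[f(X_t)]`. -/
noncomputable def semigroup (M : MarkovProcess E Ω) (t : ℝ≥0) (f : E → ℝ) (x : E) : ℝ :=
  ∫ y, f y ∂(M.transition t x)

/-- The law `ℙ_μ = ∫ ℙ_x μ(dx)` of the process with initial law `μ`. -/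
noncomputable def law (M : MarkovProcess E Ω) (μ : Measure E) : Measure Ω :=
  μ.bind M.Pr

/-- `μ` is invariant for `(P_t)`. -/
def IsInvariant (M : MarkovProcess E Ω) (μ : Measure E) : Prop :=
  ∀ t, Kernel.Invariant (M.transition t) μ

/-- `(P_t)` is symmetric with respect to `μ`. -/
def IsSymmetric (M : MarkovProcess E Ω) (μ : Measure E) : Prop :=
  ∀ t, Kernel.IsReversible (M.transition t) μ

/-- The decay property: `η` is non-increasing on `[0, ∞)` and
`Var_μ(P_t f) ≤ η(t) ‖f - ∫ f dμ‖_∞²` for all bounded (measurable) `f` and all `t ≥ 0`. -/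
def Decay (M : MarkovProcess E Ω) (μ : Measure E) (η : ℝ≥0 → ℝ) : Prop :=
  Antitone η ∧
    ∀ f : E → ℝ, Measurable f → (∃ C, ∀ x, |f x| ≤ C) → ∀ t : ℝ≥0,
      Var[M.semigroup t f; μ] ≤ η t * (⨆ x, |f x - ∫ y, f y ∂μ|) ^ 2

/-- The decay property holds for some `η` with associated mixing rate `α`: `α(r) = √η(r)` in
general, and `α(r) = η(r / 2)` is also allowed when `μ` is symmetric. -/
def DecayWithRate (M : MarkovProcess E Ω) (μ : Measure E) (α : ℝ≥0 → ℝ) : Prop :=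
  ∃ η : ℝ≥0 → ℝ, M.Decay μ η ∧
    ((∀ r, α r = √(η r)) ∨ (M.IsSymmetric μ ∧ ∀ r, α r = η (r / 2)))

end MarkovProcess

/-! Put `θ = (2-p)/p ≥ 1`, `τ = (θ/c')^θ` and `R' = R - (1 - [t]/t)`. The rate is then
`c·exp(-θ(s/τ)^{1/θ})`. If `m` is defined by `R'²t = 4 m^{1+θ} τ`, the claimed bound is exactly
`exp(-θm)` and the last proviso says `m ≥ k₀`. Since `0 < R' ≤ R`, the event for `R` lies in the
event for `R'`, so it suffices to bound the deviation `R'` (called `R` in the lemmas).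

The decay property yields an `L^∞ → L¹` mixing estimate (`DecayWithRate.isMixing`). Hence a
functional of the past and one of the future across a gap `ℓ` are independent up to an error `α(ℓ)`
times their suprema (`integral_mul_path_le`). The interval `[0,t]` is cut into `2N` blocks of length
`ℓ`; blocks of one parity are separated by gaps `ℓ`. Summed covariances bound the second moment of a
block by a multiple of `c·a·ℓ`, with correlation length `a = 2^θ τ` (`integral_sq_block_le`).

Decoupling a product of `N` nonnegative block functionals directly would multiply `α(ℓ)` by a
supremum exponential in `N`. Instead the product is stopped when it exceeds the level `L` of
interest, and each decoupling then costs only `L·α(ℓ)` (`measureReal_lt_prod_le`). Two functionals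
are used: - If `1/R ≤ 100^θ`, blocks with average above `R/4` are counted, each weighted by
`e^{32θ}`; here `N` is of order `m/R` (`measureReal_integral_le_of_count`, `count_bound_le`). - If
`1/R ≥ 100^θ`, the factor is `1 + y + y² ≥ e^y` with `y` a multiple of the block sum, and `N` is
about `16θm/R` (`measureReal_integral_le_of_exp`, `exp_bound_le`). These blocks are shorter by a
factor of order `θ`, which the smallness of `R` makes up for.

In both regimes the moment factor `G^N` stays below a constant depending on `c` alone, uniformly in
`θ`.

Only finitely many coordinates enter the Markov property, because the time integral is exactly an
average over starting points `r ∈ [0,h]` of Riemann sums of mesh `h`. Tail bounds for each `r` do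
not pass to an average over `r`, but bounds on the mean excess over a level do. -/

/-! ### The Markov property under a general initial law, for finitely many future values. -/

theorem MeasureTheory.lintegral_mul_eq_of_setLIntegral_eq {Ω : Type*} {m m0 : MeasurableSpace Ω} (hm : m ≤ m0)
    (P : Measure[m0] Ω) {F H₁ H₂ : Ω → ℝ≥0∞} (hF : Measurable[m] F) (h₁ : Measurable[m0] H₁)
    (h₂ : Measurable[m0] H₂)
    (h : ∀ A, MeasurableSet[m] A → ∫⁻ ω in A, H₁ ω ∂P = ∫⁻ ω in A, H₂ ω ∂P) :
    ∫⁻ ω, F ω * H₁ ω ∂P = ∫⁻ ω, F ω * H₂ ω ∂P := by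
  -- The measures with densities `H₁` and `H₂` agree on `m`, and an `m`-measurable integrand sees
  -- only their restrictions to `m`.
  have key : (P.withDensity H₁).trim hm = (P.withDensity H₂).trim hm := by
    refine @Measure.ext _ m _ _ fun A hA => ?_
    rw [trim_measurableSet_eq hm hA, trim_measurableSet_eq hm hA, withDensity_apply _ (hm A hA),
      withDensity_apply _ (hm A hA), h A hA]
  have hF' : Measurable[m0] F := hF.mono hm le_rfl
  have e : ∀ H : Ω → ℝ≥0∞, Measurable[m0] H →
      ∫⁻ ω, F ω * H ω ∂P = ∫⁻ ω, F ω ∂((P.withDensity H).trim hm) := fun H hH => by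
    rw [lintegral_trim hm hF, lintegral_withDensity_eq_lintegral_mul _ hH hF']
    exact lintegral_congr fun ω => mul_comm _ _
  rw [e _ h₁, e _ h₂, key]

namespace MarkovProcess

variable {E Ω : Type*} [MeasurableSpace E] [MeasurableSpace Ω]

instance (M : MarkovProcess E Ω) : IsMarkovKernel M.Pr := M.isMarkovKernel

theorem measurable_X_apply (M : MarkovProcess E Ω) (t : ℝ≥0) : Measurable (M.X t) :=
  M.measurable_X.comp (measurable_const.prodMk measurable_id)

/-- The natural filtration of the process. -/
@[reducible]
def past (M : MarkovProcess E Ω) (s : ℝ≥0) : MeasurableSpace Ω :=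
  ⨆ u : Set.Iic s, MeasurableSpace.comap (M.X u) inferInstance

theorem past_le (M : MarkovProcess E Ω) (s : ℝ≥0) : M.past s ≤ (inferInstance : MeasurableSpace Ω) :=
  iSup_le fun u => (M.measurable_X_apply u).comap_le

theorem past_mono (M : MarkovProcess E Ω) {s t : ℝ≥0} (h : s ≤ t) : M.past s ≤ M.past t :=
  iSup_le fun u => le_iSup (fun u : Set.Iic t => MeasurableSpace.comap (M.X u) inferInstance)
    ⟨u.1, le_trans u.2 h⟩

theorem measurable_X_past (M : MarkovProcess E Ω) {u s : ℝ≥0} (h : u ≤ s) :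
    Measurable[M.past s] (M.X u) :=
  Measurable.mono (comap_measurable (M.X u))
    (le_iSup (fun u : Set.Iic s => MeasurableSpace.comap (M.X u) inferInstance) ⟨u, h⟩) le_rfl

instance (M : MarkovProcess E Ω) (t : ℝ≥0) : IsMarkovKernel (M.transition t) :=
  Kernel.IsMarkovKernel.map _ (M.measurable_X_apply t)

instance (M : MarkovProcess E Ω) (μ : Measure E) [IsProbabilityMeasure μ] :
    IsProbabilityMeasure (M.law μ) := by
  unfold law; infer_instance

theorem lintegral_law (M : MarkovProcess E Ω) (ν : Measure E) {G : Ω → ℝ≥0∞} (hG : Measurable G) :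
    ∫⁻ ω, G ω ∂(M.law ν) = ∫⁻ x, ∫⁻ ω, G ω ∂(M.Pr x) ∂ν :=
  Measure.lintegral_bind M.Pr.aemeasurable hG.aemeasurable

theorem law_dirac (M : MarkovProcess E Ω) (x : E) : M.law (Measure.dirac x) = M.Pr x :=
  Measure.dirac_bind M.Pr.measurable x

theorem lintegral_transition (M : MarkovProcess E Ω) (t : ℝ≥0) (x : E) {φ : E → ℝ≥0∞}
    (hφ : Measurable φ) : ∫⁻ y, φ y ∂(M.transition t x) = ∫⁻ ω, φ (M.X t ω) ∂(M.Pr x) := by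
  rw [transition, Kernel.map_apply _ (M.measurable_X_apply t),
    lintegral_map hφ (M.measurable_X_apply t)]

theorem measurable_Pr_X (M : MarkovProcess E Ω) (s : ℝ≥0) {G : Ω → ℝ≥0∞} (hG : Measurable G) :
    Measurable fun ω => ∫⁻ ω', G ω' ∂(M.Pr (M.X s ω)) :=
  hG.lintegral_kernel.comp (M.measurable_X_apply s)

theorem markov_law_set (M : MarkovProcess E Ω) (ν : Measure E) (s t : ℝ≥0) {A : Set Ω}
    (hA : MeasurableSet[M.past s] A) {B : Set E} (hB : MeasurableSet B) :
    M.law ν (A ∩ M.X (s + t) ⁻¹' B) = ∫⁻ ω in A, M.Pr (M.X s ω) (M.X t ⁻¹' B) ∂(M.law ν) := by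
  have hA' : MeasurableSet A := M.past_le s A hA
  have hB' := M.measurable_X_apply t hB
  have hm : Measurable (A.indicator fun ω => M.Pr (M.X s ω) (M.X t ⁻¹' B)) :=
    ((M.Pr.measurable_coe hB').comp (M.measurable_X_apply s)).indicator hA'
  rw [← lintegral_indicator hA', M.lintegral_law ν hm, law,
    Measure.bind_apply (hA'.inter (M.measurable_X_apply _ hB)) M.Pr.aemeasurable]
  refine lintegral_congr fun x => ?_
  rw [lintegral_indicator hA', M.markov x s t A hA B hB]

theorem lintegral_markov (M : MarkovProcess E Ω) (ν : Measure E) (s t : ℝ≥0) {F : Ω → ℝ≥0∞}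
    (hF : Measurable[M.past s] F) {φ : E → ℝ≥0∞} (hφ : Measurable φ) :
    ∫⁻ ω, F ω * φ (M.X (s + t) ω) ∂(M.law ν)
      = ∫⁻ ω, F ω * ∫⁻ ω', φ (M.X t ω') ∂(M.Pr (M.X s ω)) ∂(M.law ν) := by
  refine lintegral_mul_eq_of_setLIntegral_eq (M.past_le s) _ hF
    (hφ.comp (M.measurable_X_apply _))
    (M.measurable_Pr_X s (hφ.comp (M.measurable_X_apply t))) fun A hA => ?_
  have key : ((M.law ν).restrict A).map (M.X (s + t))
      = (((M.law ν).restrict A).map (M.X s)).bind (M.transition t) := by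
    ext B hB
    rw [Measure.map_apply (M.measurable_X_apply _) hB,
      Measure.restrict_apply (M.measurable_X_apply _ hB), Set.inter_comm,
      M.markov_law_set ν s t hA hB, Measure.bind_apply hB (Kernel.aemeasurable _),
      lintegral_map (Kernel.measurable_coe _ hB) (M.measurable_X_apply _)]
    refine lintegral_congr fun ω => ?_
    rw [transition, Kernel.map_apply' _ (M.measurable_X_apply t) _ hB]
  rw [← lintegral_map hφ (M.measurable_X_apply (s + t)), key,
    Measure.lintegral_bind (Kernel.aemeasurable _) hφ.aemeasurable,
    lintegral_map hφ.lintegral_kernel (M.measurable_X_apply s)]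
  exact lintegral_congr fun ω => M.lintegral_transition t _ hφ

/-- Induction on the number of factors: the one-step Markov property integrates out the last factor
and absorbs it into the preceding one, which gives `ψ`. The reduction `step` holds for every initial
law, so it applies to the left side and, with a Dirac law and time `0`, to the inner integral on the
right. -/
theorem lintegral_prod_markov (M : MarkovProcess E Ω) (ν : Measure E) (s h : ℝ≥0)
    {F : Ω → ℝ≥0∞} (hF : Measurable[M.past s] F) (n : ℕ) (φ : ℕ → E → ℝ≥0∞)
    (hφ : ∀ i, Measurable (φ i)) :
    ∫⁻ ω, F ω * ∏ i ∈ Finset.range (n + 1), φ i (M.X (s + i * h) ω) ∂(M.law ν)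
      = ∫⁻ ω, F ω * ∫⁻ ω', ∏ i ∈ Finset.range (n + 1), φ i (M.X (i * h) ω') ∂(M.Pr (M.X s ω))
          ∂(M.law ν) := by
  induction n generalizing φ with
  | zero =>
    have := M.lintegral_markov ν s 0 hF (hφ 0)
    simpa using this
  | succ n ih =>
    let ψ : ℕ → E → ℝ≥0∞ := fun i x =>
      if i = n then φ n x * ∫⁻ ω', φ (n + 1) (M.X h ω') ∂(M.Pr x) else φ i x
    have hψ : ∀ i, Measurable (ψ i) := fun i => by
      by_cases hi : i = n
      · simp only [ψ, hi, if_true]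
        exact (hφ n).mul ((hφ (n + 1)).comp (M.measurable_X_apply h)).lintegral_kernel
      · simp only [ψ, hi, if_false]
        exact hφ i
    have step : ∀ (ρ : Measure E) (r : ℝ≥0) (H : Ω → ℝ≥0∞), Measurable[M.past r] H →
        ∫⁻ ω, H ω * ∏ i ∈ Finset.range (n + 1 + 1), φ i (M.X (r + i * h) ω) ∂(M.law ρ)
          = ∫⁻ ω, H ω * ∏ i ∈ Finset.range (n + 1), ψ i (M.X (r + i * h) ω) ∂(M.law ρ) := by
      intro ρ r H hH
      have hpm : Measurable[M.past (r + n * h)]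
          (fun ω => H ω * ∏ i ∈ Finset.range (n + 1), φ i (M.X (r + i * h) ω)) := by
        refine Measurable.mul (hH.mono (M.past_mono le_self_add) le_rfl) ?_
        refine Finset.measurable_prod _ fun i hi => (hφ i).comp (M.measurable_X_past ?_)
        have : i ≤ n := Nat.lt_succ_iff.mp (Finset.mem_range.mp hi)
        gcongr
      have := M.lintegral_markov ρ (r + n * h) h hpm (hφ (n + 1))
      have e1 : r + n * h + h = r + ((n + 1 : ℕ) : ℝ≥0) * h := by push_cast; ring
      rw [e1] at this
      calc _ = _ := lintegral_congr fun ω => by rw [Finset.prod_range_succ, mul_assoc]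
        _ = _ := this
        _ = _ := lintegral_congr fun ω => by
          rw [Finset.prod_range_succ, Finset.prod_range_succ (fun i => ψ i _), mul_assoc, mul_assoc]
          congr 2
          · refine Finset.prod_congr rfl fun i hi => ?_
            simp [ψ, (Finset.mem_range.mp hi).ne]
          · simp [ψ]
    rw [step ν s F hF, ih ψ hψ]
    refine lintegral_congr fun ω => ?_
    have := step (Measure.dirac (M.X s ω)) 0 (fun _ => 1) measurable_const
    simp only [one_mul, zero_add, law_dirac] at this
    rw [this]

theorem measurable_path (M : MarkovProcess E Ω) (s h : ℝ≥0) (q : ℕ) :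
    Measurable fun ω (i : Fin q) => M.X (s + i * h) ω :=
  measurable_pi_lambda _ fun _ => M.measurable_X_apply _

/-- The Markov property for functionals of finitely many equally spaced future values. -/
theorem lintegral_path_markov (M : MarkovProcess E Ω) (ν : Measure E) (s h : ℝ≥0) (q : ℕ)
    {F : Ω → ℝ≥0∞} (hF : Measurable[M.past s] F) (hFi : ∫⁻ ω, F ω ∂(M.law ν) ≠ ∞)
    {Ψ : (Fin q → E) → ℝ≥0∞} (hΨ : Measurable Ψ) :
    ∫⁻ ω, F ω * Ψ (fun i => M.X (s + i * h) ω) ∂(M.law ν)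
      = ∫⁻ ω, F ω * ∫⁻ ω', Ψ (fun i => M.X (0 + i * h) ω') ∂(M.Pr (M.X s ω)) ∂(M.law ν) := by
  have hF' : Measurable F := hF.mono (M.past_le s) le_rfl
  let κ : Kernel E (Fin q → E) := M.Pr.map fun ω i => M.X (0 + i * h) ω
  have : IsMarkovKernel κ := Kernel.IsMarkovKernel.map _ (M.measurable_path 0 h q)
  have : IsFiniteMeasure ((M.law ν).withDensity F) := isFiniteMeasure_withDensity hFi
  have e : ∀ G : Ω → ℝ≥0∞, Measurable G →
      ∫⁻ ω, F ω * G ω ∂(M.law ν) = ∫⁻ ω, G ω ∂((M.law ν).withDensity F) := fun G hG =>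
    (lintegral_withDensity_eq_lintegral_mul _ hF' hG).symm
  have lhs : ∀ Φ : (Fin q → E) → ℝ≥0∞, Measurable Φ →
      ∫⁻ ω, F ω * Φ (fun i => M.X (s + i * h) ω) ∂(M.law ν)
        = ∫⁻ z, Φ z ∂(((M.law ν).withDensity F).map fun ω (i : Fin q) => M.X (s + i * h) ω) :=
    fun Φ hΦ => by
      rw [lintegral_map hΦ (M.measurable_path s h q)]
      exact e _ (hΦ.comp (M.measurable_path s h q))
  have rhs : ∀ Φ : (Fin q → E) → ℝ≥0∞, Measurable Φ →
      ∫⁻ ω, F ω * ∫⁻ ω', Φ (fun i => M.X (0 + i * h) ω') ∂(M.Pr (M.X s ω)) ∂(M.law ν)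
        = ∫⁻ z, Φ z ∂((((M.law ν).withDensity F).map (M.X s)).bind κ) := fun Φ hΦ => by
      refine (e _ (M.measurable_Pr_X s (hΦ.comp (M.measurable_path 0 h q)))).trans ?_
      rw [Measure.lintegral_bind (Kernel.aemeasurable _) hΦ.aemeasurable,
        lintegral_map hΦ.lintegral_kernel (M.measurable_X_apply s)]
      refine lintegral_congr fun ω => ?_
      rw [Kernel.map_apply _ (M.measurable_path 0 h q), lintegral_map hΦ (M.measurable_path 0 h q)]
      rfl
  have hbox : ∀ B : Fin q → Set E, (∀ i, MeasurableSet (B i)) →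
      ((M.law ν).withDensity F).map (fun ω (i : Fin q) => M.X (s + i * h) ω) (Set.univ.pi B)
        = (((M.law ν).withDensity F).map (M.X s)).bind κ (Set.univ.pi B) := by
    intro B hB
    have hBox : MeasurableSet (Set.univ.pi B) := MeasurableSet.univ_pi hB
    rw [← lintegral_indicator_one hBox, ← lintegral_indicator_one hBox,
      ← lhs _ (measurable_one.indicator hBox), ← rhs _ (measurable_one.indicator hBox)]
    -- The product formula has `q + 1` factors; the extra factor at index `q` is made trivial by
    -- taking the whole space.
    let φ : ℕ → E → ℝ≥0∞ := fun i =>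
      (if hi : i < q then B ⟨i, hi⟩ else Set.univ).indicator 1
    have hφ : ∀ i, Measurable (φ i) := fun i => by
      refine measurable_one.indicator ?_
      split_ifs with hi
      exacts [hB _, MeasurableSet.univ]
    have hprod : ∀ z : ℕ → E, (Set.univ.pi B).indicator (1 : (Fin q → E) → ℝ≥0∞)
        (fun i : Fin q => z i) = ∏ i ∈ Finset.range (q + 1), φ i (z i) := fun z => by
      by_cases hz : (fun i : Fin q => z i) ∈ Set.univ.pi B
      · rw [Set.indicator_of_mem hz, Finset.prod_eq_one]
        · rfl
        · intro i _
          by_cases hi : i < q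
          · have hφi : φ i = (B ⟨i, hi⟩).indicator 1 := by simp only [φ]; rw [dif_pos hi]
            rw [hφi, Set.indicator_of_mem (hz ⟨i, hi⟩ trivial), Pi.one_apply]
          · simp [φ, hi]
      · rw [Set.indicator_of_notMem hz]
        simp only [Set.mem_univ_pi, not_forall] at hz
        obtain ⟨i, hi⟩ := hz
        refine (Finset.prod_eq_zero (i := i.1) (by simp) ?_).symm
        simp [φ, hi]
    have := M.lintegral_prod_markov ν s h hF q φ hφ
    calc _ = _ := lintegral_congr fun ω => by rw [hprod fun i => M.X (s + i * h) ω]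
      _ = _ := this
      _ = _ := lintegral_congr fun ω => by
        congr 1
        refine lintegral_congr fun ω' => ?_
        rw [hprod fun i => M.X (0 + i * h) ω']
        simp only [zero_add]
  have key : ((M.law ν).withDensity F).map (fun ω (i : Fin q) => M.X (s + i * h) ω)
      = (((M.law ν).withDensity F).map (M.X s)).bind κ := by
    have : IsFiniteMeasure (((M.law ν).withDensity F).map
      (fun ω (i : Fin q) => M.X (s + i * h) ω)) := Measure.isFiniteMeasure_map _ _
    refine ext_of_generate_finite _ generateFrom_pi.symm isPiSystem_pi ?_ ?_
    · rintro _ ⟨B, hB, rfl⟩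
      exact hbox B fun i => hB i trivial
    · simpa only [Set.pi_univ] using hbox (fun _ => Set.univ) fun _ => MeasurableSet.univ
  rw [lhs _ hΨ, rhs _ hΨ, key]

/-! ### Stationarity and the semigroup on bounded functions. -/

theorem law_map_X (M : MarkovProcess E Ω) {μ : Measure E} (hμ : M.IsInvariant μ) (s : ℝ≥0) :
    (M.law μ).map (M.X s) = μ := by
  ext B hB
  rw [Measure.map_apply (M.measurable_X_apply s) hB, law,
    Measure.bind_apply (M.measurable_X_apply s hB) M.Pr.aemeasurable]
  conv_rhs => rw [← hμ s]
  rw [Measure.bind_apply hB (Kernel.aemeasurable _)]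
  refine lintegral_congr fun x => ?_
  rw [transition, Kernel.map_apply' _ (M.measurable_X_apply s) _ hB]

theorem lintegral_law_X (M : MarkovProcess E Ω) {μ : Measure E} (hμ : M.IsInvariant μ) (s : ℝ≥0)
    {φ : E → ℝ≥0∞} (hφ : Measurable φ) : ∫⁻ ω, φ (M.X s ω) ∂(M.law μ) = ∫⁻ x, φ x ∂μ := by
  rw [← lintegral_map hφ (M.measurable_X_apply s), M.law_map_X hμ]

theorem _root_.MeasureTheory.integrable_of_forall_abs_le {α : Type*} [MeasurableSpace α]
    {P : Measure α} [IsFiniteMeasure P] {f : α → ℝ} (hf : Measurable f) {C : ℝ}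
    (hC : ∀ x, |f x| ≤ C) : Integrable f P :=
  Integrable.of_bound hf.aestronglyMeasurable C (ae_of_all _ hC)

theorem _root_.MeasureTheory.abs_integral_le_of_forall_abs_le {α : Type*} [MeasurableSpace α]
    {P : Measure α} [IsProbabilityMeasure P] {f : α → ℝ} {C : ℝ}
    (hC : ∀ x, |f x| ≤ C) : |∫ x, f x ∂P| ≤ C := by
  simpa using norm_integral_le_of_norm_le_const (μ := P) (f := f) (C := C) (ae_of_all _ hC)

theorem measurable_semigroup (M : MarkovProcess E Ω) (t : ℝ≥0) {f : E → ℝ} (hf : Measurable f) :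
    Measurable (M.semigroup t f) :=
  (hf.stronglyMeasurable.integral_kernel (κ := M.transition t)).measurable

theorem abs_semigroup_le (M : MarkovProcess E Ω) (t : ℝ≥0) {f : E → ℝ} {C : ℝ}
    (hC : ∀ x, |f x| ≤ C) (x : E) : |M.semigroup t f x| ≤ C :=
  abs_integral_le_of_forall_abs_le hC

theorem semigroup_eq_integral_Pr (M : MarkovProcess E Ω) (t : ℝ≥0) {f : E → ℝ} (hf : Measurable f)
    (x : E) : M.semigroup t f x = ∫ ω, f (M.X t ω) ∂(M.Pr x) := by
  rw [semigroup, transition, Kernel.map_apply _ (M.measurable_X_apply t),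
    integral_map (M.measurable_X_apply t).aemeasurable hf.aestronglyMeasurable]

theorem transition_add (M : MarkovProcess E Ω) (s t : ℝ≥0) :
    M.transition (s + t) = M.transition t ∘ₖ M.transition s := by
  ext x B hB
  have := M.markov_law_set (Measure.dirac x) s t MeasurableSet.univ hB
  rw [law_dirac, Set.univ_inter, Measure.restrict_univ] at this
  rw [Kernel.comp_apply' _ _ _ hB, M.lintegral_transition s x (Kernel.measurable_coe _ hB),
    transition, Kernel.map_apply' _ (M.measurable_X_apply _) _ hB, this]
  refine lintegral_congr fun ω => ?_
  rw [transition, Kernel.map_apply' _ (M.measurable_X_apply _) _ hB]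

theorem semigroup_add (M : MarkovProcess E Ω) (s t : ℝ≥0) {f : E → ℝ} (hf : Measurable f) {C : ℝ}
    (hC : ∀ x, |f x| ≤ C) (x : E) : M.semigroup (s + t) f x = M.semigroup s (M.semigroup t f) x := by
  rw [semigroup, transition_add, Kernel.integral_comp (integrable_of_forall_abs_le hf hC)]
  rfl

theorem integral_compProd_transition (M : MarkovProcess E Ω) (μ : Measure E)
    [IsProbabilityMeasure μ] (t : ℝ≥0) {f g : E → ℝ} (hf : Measurable f) (hg : Measurable g)
    {C D : ℝ} (hC : ∀ x, |f x| ≤ C) (hD : ∀ x, |g x| ≤ D) :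
    ∫ z, f z.1 * g z.2 ∂(μ ⊗ₘ M.transition t) = ∫ x, f x * M.semigroup t g x ∂μ := by
  rw [Measure.integral_compProd]
  · exact integral_congr_ae (ae_of_all _ fun x => integral_const_mul (f x) g)
  · refine integrable_of_forall_abs_le (C := C * D)
      ((hf.comp measurable_fst).mul (hg.comp measurable_snd)) fun z => ?_
    rw [abs_mul]
    exact mul_le_mul (hC _) (hD _) (abs_nonneg _) ((abs_nonneg _).trans (hC z.1))

theorem integral_semigroup (M : MarkovProcess E Ω) {μ : Measure E} [IsProbabilityMeasure μ]
    (hμ : M.IsInvariant μ) (t : ℝ≥0) {f : E → ℝ} (hf : Measurable f) {C : ℝ}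
    (hC : ∀ x, |f x| ≤ C) : ∫ x, M.semigroup t f x ∂μ = ∫ x, f x ∂μ := by
  have h1 := M.integral_compProd_transition μ t (f := fun _ => 1) (C := 1) measurable_const hf
    (by simp) hC
  simp only [one_mul] at h1
  have h2 : (μ ⊗ₘ M.transition t).map Prod.snd = μ := by
    have := Measure.snd_compProd μ (M.transition t)
    rw [hμ t] at this
    exact this
  rw [← h1]
  conv_rhs => rw [← h2]
  rw [integral_map measurable_snd.aemeasurable hf.aestronglyMeasurable]

theorem law_map_pair (M : MarkovProcess E Ω) {μ : Measure E} [IsProbabilityMeasure μ]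
    (hμ : M.IsInvariant μ) (u t : ℝ≥0) :
    (M.law μ).map (fun ω => (M.X u ω, M.X (u + t) ω)) = μ ⊗ₘ M.transition t := by
  have hm : Measurable fun ω => (M.X u ω, M.X (u + t) ω) :=
    (M.measurable_X_apply u).prodMk (M.measurable_X_apply _)
  have : IsProbabilityMeasure ((M.law μ).map fun ω => (M.X u ω, M.X (u + t) ω)) :=
    Measure.isProbabilityMeasure_map hm.aemeasurable
  refine Measure.ext_prod fun {A B} hA hB => ?_
  rw [Measure.map_apply hm (hA.prod hB), Measure.compProd_apply_prod hA hB]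
  have h1 := M.markov_law_set μ u t (M.measurable_X_past le_rfl hA) hB
  refine (Eq.trans ?_ h1).trans ?_
  · rfl
  · have hk : Measurable fun x => M.transition t x B := Kernel.measurable_coe _ hB
    rw [← lintegral_indicator hA, ← M.lintegral_law_X hμ u (hk.indicator hA),
      ← lintegral_indicator (M.measurable_X_apply u hA)]
    refine lintegral_congr fun ω => ?_
    by_cases h : M.X u ω ∈ A
    · rw [Set.indicator_of_mem h, Set.indicator_of_mem (by exact h), transition,
        Kernel.map_apply' _ (M.measurable_X_apply t) _ hB]
    · rw [Set.indicator_of_notMem h, Set.indicator_of_notMem (by exact h)]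

theorem integral_law_X (M : MarkovProcess E Ω) {μ : Measure E} (hμ : M.IsInvariant μ) (s : ℝ≥0)
    {f : E → ℝ} (hf : Measurable f) : ∫ ω, f (M.X s ω) ∂(M.law μ) = ∫ x, f x ∂μ := by
  rw [← integral_map (M.measurable_X_apply s).aemeasurable hf.aestronglyMeasurable,
    M.law_map_X hμ]

theorem integral_mul_law_X (M : MarkovProcess E Ω) {μ : Measure E} [IsProbabilityMeasure μ]
    (hμ : M.IsInvariant μ) (u t : ℝ≥0) {f g : E → ℝ} (hf : Measurable f) (hg : Measurable g)
    {C D : ℝ} (hC : ∀ x, |f x| ≤ C) (hD : ∀ x, |g x| ≤ D) :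
    ∫ ω, f (M.X u ω) * g (M.X (u + t) ω) ∂(M.law μ) = ∫ x, f x * M.semigroup t g x ∂μ := by
  rw [← M.integral_compProd_transition μ t hf hg hC hD, ← M.law_map_pair hμ u t]
  exact (integral_map ((M.measurable_X_apply u).prodMk (M.measurable_X_apply _)).aemeasurable
    ((hf.comp measurable_fst).mul (hg.comp measurable_snd)).aestronglyMeasurable).symm

theorem integral_mul_semigroup_comm (M : MarkovProcess E Ω) {μ : Measure E}
    [IsProbabilityMeasure μ] (hs : M.IsSymmetric μ) (t : ℝ≥0) {f g : E → ℝ} (hf : Measurable f)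
    (hg : Measurable g) {C D : ℝ} (hC : ∀ x, |f x| ≤ C) (hD : ∀ x, |g x| ≤ D) :
    ∫ x, f x * M.semigroup t g x ∂μ = ∫ x, g x * M.semigroup t f x ∂μ := by
  rw [← M.integral_compProd_transition μ t hf hg hC hD,
    ← M.integral_compProd_transition μ t hg hf hD hC]
  have key : (μ ⊗ₘ M.transition t).map Prod.swap = μ ⊗ₘ M.transition t := by
    have : IsProbabilityMeasure ((μ ⊗ₘ M.transition t).map Prod.swap) :=
      Measure.isProbabilityMeasure_map measurable_swap.aemeasurable
    refine Measure.ext_prod fun {A B} hA hB => ?_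
    rw [Measure.map_apply measurable_swap (hA.prod hB), Set.preimage_swap_prod,
      Measure.compProd_apply_prod hA hB, Measure.compProd_apply_prod hB hA, hs t hB hA]
  conv_rhs => rw [← key]
  refine Eq.trans ?_ (integral_map measurable_swap.aemeasurable
    ((hg.comp measurable_fst).mul (hf.comp measurable_snd)).aestronglyMeasurable).symm
  exact integral_congr_ae (ae_of_all _ fun z => mul_comm _ _)

/-! ### From variance decay to `L¹` mixing. -/

theorem _root_.ProbabilityTheory.integral_abs_sub_le_sqrt_variance {α : Type*} [MeasurableSpace α]
    {P : Measure α} [IsProbabilityMeasure P] {f : α → ℝ} (hf : Measurable f) {C : ℝ}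
    (hC : ∀ x, |f x| ≤ C) : ∫ x, |f x - ∫ y, f y ∂P| ∂P ≤ √(Var[f; P]) := by
  have hm : Measurable fun x => |f x - ∫ y, f y ∂P| := (hf.sub_const _).abs
  have hb : ∀ x, |f x - ∫ y, f y ∂P| ≤ C + C := fun x =>
    (abs_sub _ _).trans (add_le_add (hC x) (abs_integral_le_of_forall_abs_le hC))
  have hL : MemLp (fun x => |f x - ∫ y, f y ∂P|) 2 P :=
    MemLp.of_bound hm.aestronglyMeasurable (C + C)
      (ae_of_all _ fun x => by rw [Real.norm_eq_abs, abs_abs]; exact hb x)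
  have h1 := variance_eq_sub hL
  have h2 := variance_nonneg (fun x => |f x - ∫ y, f y ∂P|) P
  refine Real.le_sqrt_of_sq_le ?_
  rw [variance_eq_integral hf.aemeasurable]
  have h3 : P[(fun x => |f x - ∫ y, f y ∂P|) ^ 2] = ∫ x, (f x - ∫ y, f y ∂P) ^ 2 ∂P :=
    integral_congr_ae (ae_of_all _ fun x => by simp)
  rw [h3] at h1
  linarith

/-- `α` bounds the speed of convergence to equilibrium from `L^∞` to `L¹`, up to a factor `2`. -/
def IsMixing (M : MarkovProcess E Ω) (μ : Measure E) (α : ℝ≥0 → ℝ) : Prop :=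
  ∀ (f : E → ℝ) (K : ℝ), Measurable f → (∀ x, |f x - ∫ y, f y ∂μ| ≤ K) → ∀ s,
    ∫ x, |M.semigroup s f x - ∫ y, f y ∂μ| ∂μ ≤ 2 * α s * K

theorem Decay.variance_le {M : MarkovProcess E Ω} {μ : Measure E} [IsProbabilityMeasure μ]
    {η : ℝ≥0 → ℝ} (h : M.Decay μ η) {f : E → ℝ} (hf : Measurable f) {K : ℝ}
    (hK : ∀ x, |f x - ∫ y, f y ∂μ| ≤ K) (s : ℝ≥0) :
    √(Var[M.semigroup s f; μ]) ≤ √(η s) * K := by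
  obtain ⟨x₀⟩ : Nonempty E := nonempty_of_isProbabilityMeasure μ
  have hb : ∀ x, |f x| ≤ K + |∫ y, f y ∂μ| := fun x => by
    have := abs_add_le (f x - ∫ y, f y ∂μ) (∫ y, f y ∂μ)
    rw [sub_add_cancel] at this
    linarith [hK x]
  have : Nonempty E := ⟨x₀⟩
  have h0 : 0 ≤ ⨆ x, |f x - ∫ y, f y ∂μ| := Real.iSup_nonneg fun x => abs_nonneg _
  have h1 : ⨆ x, |f x - ∫ y, f y ∂μ| ≤ K := ciSup_le hK
  calc √(Var[M.semigroup s f; μ]) ≤ √(η s * (⨆ x, |f x - ∫ y, f y ∂μ|) ^ 2) :=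
        Real.sqrt_le_sqrt (h.2 f hf ⟨_, hb⟩ s)
    _ = √(η s) * (⨆ x, |f x - ∫ y, f y ∂μ|) := by
        rw [Real.sqrt_mul' _ (sq_nonneg _), Real.sqrt_sq h0]
    _ ≤ √(η s) * K := by gcongr

theorem Decay.integral_abs_le {M : MarkovProcess E Ω} {μ : Measure E} [IsProbabilityMeasure μ]
    (hμ : M.IsInvariant μ) {η : ℝ≥0 → ℝ} (h : M.Decay μ η) {f : E → ℝ} (hf : Measurable f) {K : ℝ}
    (hK : ∀ x, |f x - ∫ y, f y ∂μ| ≤ K) (s : ℝ≥0) :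
    ∫ x, |M.semigroup s f x - ∫ y, f y ∂μ| ∂μ ≤ √(η s) * K := by
  have hb : ∀ x, |f x| ≤ K + |∫ y, f y ∂μ| := fun x => by
    have := abs_add_le (f x - ∫ y, f y ∂μ) (∫ y, f y ∂μ)
    rw [sub_add_cancel] at this
    linarith [hK x]
  have := integral_abs_sub_le_sqrt_variance (P := μ) (M.measurable_semigroup s hf)
    (M.abs_semigroup_le s hb)
  rw [M.integral_semigroup hμ s hf hb] at this
  exact this.trans (h.variance_le hf hK s)

/-- For `α = √η` this is Cauchy–Schwarz. In the symmetric case, test `P_s u` against its sign `σ`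
and move half of the time onto `σ`: the integral becomes `∫ P_{s/2}u · (P_{s/2}σ - ∫σ dμ) dμ`, a
product of two functions whose `L²` norms both decay like `√η(s/2)`. The factor `2` in `IsMixing`
comes from `|σ - ∫σ dμ| ≤ 2`. -/
theorem DecayWithRate.isMixing {M : MarkovProcess E Ω} {μ : Measure E} [IsProbabilityMeasure μ]
    (hμ : M.IsInvariant μ) {α : ℝ≥0 → ℝ} (h : M.DecayWithRate μ α) (hα : ∀ s, 0 ≤ α s) :
    M.IsMixing μ α := by
  intro f K hf hK s
  obtain ⟨x₀⟩ : Nonempty E := nonempty_of_isProbabilityMeasure μ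
  have hK0 : 0 ≤ K := (abs_nonneg _).trans (hK x₀)
  obtain ⟨η, hη, hr | ⟨hs, hr⟩⟩ := h
  · have := hη.integral_abs_le hμ hf hK s
    rw [← hr s] at this
    nlinarith [mul_nonneg (hα s) hK0]
  · set m := ∫ y, f y ∂μ with hm
    let u : E → ℝ := fun x => f x - m
    have hu : Measurable u := hf.sub_const _
    have hfb : ∀ x, |f x| ≤ K + |m| := fun x => by
      have := abs_add_le (f x - m) m
      rw [sub_add_cancel] at this
      linarith [hK x]
    have hum : ∫ y, u y ∂μ = 0 := by
      rw [integral_sub (integrable_of_forall_abs_le hf hfb) (integrable_const _)]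
      simp [hm]
    have hPu : ∀ x, M.semigroup s u x = M.semigroup s f x - m := fun x => by
      simp only [semigroup, u]
      rw [integral_sub (integrable_of_forall_abs_le hf hfb) (integrable_const _)]
      simp
    let σ : E → ℝ := fun x => if 0 ≤ M.semigroup s u x then 1 else -1
    have hσ : Measurable σ := Measurable.ite
      (measurableSet_le measurable_const (M.measurable_semigroup s hu)) measurable_const
      measurable_const
    have hσb : ∀ x, |σ x| ≤ 1 := fun x => by simp only [σ]; split_ifs <;> simp
    set r := s / 2 with hrdef
    have hsr : s = r + r := (add_halves s).symm
    have e1 : ∫ x, |M.semigroup s f x - m| ∂μ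
        = ∫ x, M.semigroup r u x * M.semigroup r σ x ∂μ := by
      rw [← M.integral_mul_semigroup_comm hs r hσ (M.measurable_semigroup r hu) hσb
        (M.abs_semigroup_le r hK)]
      refine integral_congr_ae (ae_of_all _ fun x => ?_)
      simp only
      rw [← M.semigroup_add r r hu hK, ← hsr, ← hPu]
      simp only [σ]
      split_ifs with hx
      · rw [abs_of_nonneg hx, one_mul]
      · rw [abs_of_neg (not_le.mp hx), neg_one_mul]
    set b := ∫ y, σ y ∂μ with hb
    have hηr : 0 ≤ η r := by rw [hrdef, ← hr s]; exact hα s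
    have hbb : |b| ≤ 1 := abs_integral_le_of_forall_abs_le hσb
    have var_le : ∀ {g : E → ℝ} {L : ℝ}, Measurable g → 0 ≤ L → (∀ x, |g x - ∫ y, g y ∂μ| ≤ L) →
        (∀ x, |g x| ≤ L) → ∫ x, (M.semigroup r g x - ∫ y, g y ∂μ) ^ 2 ∂μ ≤ η r * L ^ 2 := by
      intro g L hg hL0 hL hgL
      have h1 := hη.variance_le hg hL r
      rw [← Real.sqrt_sq hL0, ← Real.sqrt_mul hηr] at h1
      have h2 := (Real.sqrt_le_sqrt_iff (mul_nonneg hηr (sq_nonneg L))).mp h1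
      rwa [variance_eq_integral (M.measurable_semigroup r hg).aemeasurable,
        M.integral_semigroup hμ r hg hgL] at h2
    have hA := var_le hu hK0 (by simpa [hum] using hK) hK
    have hB := var_le hσ zero_le_two
      (fun x => (abs_sub _ _).trans (by linarith [hσb x])) (fun x => (hσb x).trans one_le_two)
    rw [hum] at hA
    simp only [sub_zero] at hA
    rw [← hb] at hB
    have hAm := M.measurable_semigroup r hu
    have hBm := M.measurable_semigroup r hσ
    have hAb := M.abs_semigroup_le r hK
    have hBb := M.abs_semigroup_le r hσb
    have hAi := integrable_of_forall_abs_le (P := μ) hAm hAb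
    have hA2i : Integrable (fun x => M.semigroup r u x ^ 2) μ :=
      integrable_of_forall_abs_le (C := K ^ 2) (hAm.pow_const 2) fun x => by
        rw [abs_pow]; gcongr; exact hAb x
    have hB2i : Integrable (fun x => (M.semigroup r σ x - b) ^ 2) μ :=
      integrable_of_forall_abs_le (C := 2 ^ 2) ((hBm.sub_const b).pow_const 2) fun x => by
        rw [abs_pow]; gcongr; exact (abs_sub _ _).trans (by linarith [hBb x])
    have hABi : Integrable (fun x => M.semigroup r u x * M.semigroup r σ x) μ :=
      integrable_of_forall_abs_le (C := K * 1) (hAm.mul hBm) fun x => by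
        rw [abs_mul]; gcongr; exacts [hAb x, hBb x]
    have e2 : ∫ x, M.semigroup r u x * M.semigroup r σ x ∂μ
        = ∫ x, M.semigroup r u x * (M.semigroup r σ x - b) ∂μ := by
      have : ∀ x, M.semigroup r u x * (M.semigroup r σ x - b)
        = M.semigroup r u x * M.semigroup r σ x - M.semigroup r u x * b := fun x => mul_sub _ _ _
      simp_rw [this]
      rw [integral_sub hABi (hAi.mul_const b), integral_mul_const,
        M.integral_semigroup hμ r hu hK, hum]
      simp
    rw [e1, e2, hr s]
    rcases hK0.eq_or_lt with rfl | hKpos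
    · have : ∀ x, M.semigroup r u x = 0 := fun x => abs_nonpos_iff.mp (hAb x)
      simp [this]
    · calc ∫ x, M.semigroup r u x * (M.semigroup r σ x - b) ∂μ
          -- Cauchy–Schwarz in the form `AB ≤ A²/K + K B²/4`, the weights being matched to the
          -- bounds `η K²` and `4η` of the two second moments.
          ≤ ∫ x, (K⁻¹ * M.semigroup r u x ^ 2 + K / 4 * (M.semigroup r σ x - b) ^ 2) ∂μ := by
            refine integral_mono ?_ ((hA2i.const_mul _).add (hB2i.const_mul _)) fun x => ?_
            · have := hABi.sub (hAi.mul_const b)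
              exact this.congr (ae_of_all _ fun x => (mul_sub _ _ _).symm)
            · simp only
              have := sq_nonneg (K⁻¹ * M.semigroup r u x - (M.semigroup r σ x - b) / 2)
              have h3 := mul_nonneg hKpos.le this
              have h4 : K * (K⁻¹ * M.semigroup r u x - (M.semigroup r σ x - b) / 2) ^ 2
                = K⁻¹ * M.semigroup r u x ^ 2 + K / 4 * (M.semigroup r σ x - b) ^ 2
                  - M.semigroup r u x * (M.semigroup r σ x - b) := by
                field_simp; ring
              linarith
        _ = K⁻¹ * ∫ x, M.semigroup r u x ^ 2 ∂μ
            + K / 4 * ∫ x, (M.semigroup r σ x - b) ^ 2 ∂μ := by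
            rw [integral_add (hA2i.const_mul _) (hB2i.const_mul _), integral_const_mul,
              integral_const_mul]
        _ ≤ K⁻¹ * (η r * K ^ 2) + K / 4 * (η r * 2 ^ 2) := by gcongr
        _ = 2 * η (s / 2) * K := by rw [← hrdef]; field_simp; ring

/-! ### Decoupling of past and future. -/

theorem measurable_integral_Pr (M : MarkovProcess E Ω) {G : Ω → ℝ} (hG : Measurable G) :
    Measurable fun x => ∫ ω, G ω ∂(M.Pr x) :=
  (hG.stronglyMeasurable.integral_kernel (κ := M.Pr)).measurable

theorem integral_path_markov (M : MarkovProcess E Ω) (μ : Measure E) [IsProbabilityMeasure μ]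
    (s h : ℝ≥0) (q : ℕ) {F : Ω → ℝ} (hF : Measurable[M.past s] F) (hF0 : ∀ ω, 0 ≤ F ω) {L : ℝ}
    (hFL : ∀ ω, F ω ≤ L) {Ψ : (Fin q → E) → ℝ} (hΨ : Measurable Ψ) (hΨ0 : ∀ z, 0 ≤ Ψ z) {D : ℝ}
    (hΨD : ∀ z, Ψ z ≤ D) :
    ∫ ω, F ω * Ψ (fun i => M.X (s + i * h) ω) ∂(M.law μ)
      = ∫ ω, F ω * ∫ ω', Ψ (fun i => M.X (0 + i * h) ω') ∂(M.Pr (M.X s ω)) ∂(M.law μ) := by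
  have hF' : Measurable F := hF.mono (M.past_le s) le_rfl
  have hp := hΨ.comp (M.measurable_path s h q)
  have hp0 : Measurable fun ω => Ψ (fun i : Fin q => M.X (0 + i * h) ω) :=
    hΨ.comp (M.measurable_path 0 h q)
  have hFi : ∫⁻ ω, ENNReal.ofReal (F ω) ∂(M.law μ) ≠ ∞ := by
    refine ((lintegral_mono fun ω => ENNReal.ofReal_le_ofReal (hFL ω)).trans_lt ?_).ne
    simp
  have hg : ∀ ω, 0 ≤ ∫ ω', Ψ (fun i => M.X (0 + i * h) ω') ∂(M.Pr (M.X s ω)) := fun ω =>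
    integral_nonneg fun ω' => hΨ0 _
  rw [integral_eq_lintegral_of_nonneg_ae (ae_of_all _ fun ω => mul_nonneg (hF0 ω) (hΨ0 _))
      (hF'.mul hp).aestronglyMeasurable,
    integral_eq_lintegral_of_nonneg_ae (ae_of_all _ fun ω => mul_nonneg (hF0 ω) (hg ω))
      (hF'.mul ((M.measurable_integral_Pr hp0).comp (M.measurable_X_apply s))).aestronglyMeasurable]
  congr 1
  have := M.lintegral_path_markov μ s h q hF.ennreal_ofReal hFi hΨ.ennreal_ofReal
  refine Eq.trans (lintegral_congr fun ω => ENNReal.ofReal_mul (hF0 ω)) (this.trans ?_)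
  refine lintegral_congr fun ω => ?_
  rw [ENNReal.ofReal_mul (hF0 ω), ofReal_integral_eq_lintegral_ofReal]
  · exact integrable_of_forall_abs_le (C := D) hp0 fun ω' => by
      rw [abs_of_nonneg (hΨ0 _)]; exact hΨD _
  · exact ae_of_all _ fun ω' => hΨ0 _

theorem integral_path_stationary (M : MarkovProcess E Ω) {μ : Measure E} [IsProbabilityMeasure μ]
    (hμ : M.IsInvariant μ) (s h : ℝ≥0) (q : ℕ) {Ψ : (Fin q → E) → ℝ} (hΨ : Measurable Ψ)
    (hΨ0 : ∀ z, 0 ≤ Ψ z) {D : ℝ} (hΨD : ∀ z, Ψ z ≤ D) :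
    ∫ ω, Ψ (fun i => M.X (s + i * h) ω) ∂(M.law μ)
      = ∫ x, ∫ ω', Ψ (fun i => M.X (0 + i * h) ω') ∂(M.Pr x) ∂μ := by
  have := M.integral_path_markov μ s h q (F := fun _ => 1) (L := 1) measurable_const (by simp)
    (by simp) hΨ hΨ0 hΨD
  simp only [one_mul] at this
  rw [this]
  exact M.integral_law_X hμ s (M.measurable_integral_Pr (hΨ.comp (M.measurable_path 0 h q)))

/-- Decoupling of a functional of the past from one of the future, across a gap `ℓ`. -/
theorem integral_mul_path_le (M : MarkovProcess E Ω) {μ : Measure E} [IsProbabilityMeasure μ]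
    (hμ : M.IsInvariant μ) {α : ℝ≥0 → ℝ} (hα : M.IsMixing μ α) (u ℓ h : ℝ≥0) (q : ℕ)
    {F : Ω → ℝ} (hF : Measurable[M.past u] F) (hF0 : ∀ ω, 0 ≤ F ω) {L : ℝ}
    (hFL : ∀ ω, F ω ≤ L) {Ψ : (Fin q → E) → ℝ} (hΨ : Measurable Ψ) (hΨ0 : ∀ z, 0 ≤ Ψ z) {D : ℝ}
    (hΨD : ∀ z, Ψ z ≤ D) :
    ∫ ω, F ω * Ψ (fun i => M.X (u + ℓ + i * h) ω) ∂(M.law μ)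
      ≤ (∫ ω, F ω ∂(M.law μ)) * (∫ x, ∫ ω', Ψ (fun i => M.X (0 + i * h) ω') ∂(M.Pr x) ∂μ)
        + L * (2 * α ℓ * D) := by
  obtain ⟨ω₀⟩ : Nonempty Ω := nonempty_of_isProbabilityMeasure (M.law μ)
  have hL0 : 0 ≤ L := (hF0 ω₀).trans (hFL ω₀)
  have hF' : Measurable F := hF.mono (M.past_le u) le_rfl
  have hFb : ∀ ω, |F ω| ≤ L := fun ω => by rw [abs_of_nonneg (hF0 ω)]; exact hFL ω
  rw [M.integral_path_markov μ (u + ℓ) h q (hF.mono (M.past_mono le_self_add) le_rfl) hF0 hFL hΨ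
    hΨ0 hΨD]
  set g : E → ℝ := fun x => ∫ ω', Ψ (fun i => M.X (0 + i * h) ω') ∂(M.Pr x) with hg
  have hgm : Measurable g := M.measurable_integral_Pr (hΨ.comp (M.measurable_path 0 h q))
  have hg0 : ∀ x, 0 ≤ g x := fun x => integral_nonneg fun ω' => hΨ0 _
  have hgD : ∀ x, |g x| ≤ D := fun x =>
    abs_integral_le_of_forall_abs_le fun ω => by rw [abs_of_nonneg (hΨ0 _)]; exact hΨD _
  -- Both numbers lie in `[0, D]`, so the deviation is at most `D` and not `2D`.
  have hgK : ∀ x, |g x - ∫ y, g y ∂μ| ≤ D := fun x => by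
    have h1 : 0 ≤ ∫ y, g y ∂μ := integral_nonneg hg0
    have h2 := abs_integral_le_of_forall_abs_le (P := μ) hgD
    rw [abs_of_nonneg h1] at h2
    have h3 := hgD x
    rw [abs_of_nonneg (hg0 x)] at h3
    rw [abs_le]; constructor <;> linarith [hg0 x]
  have hPm := M.measurable_semigroup ℓ hgm
  have hPb := M.abs_semigroup_le ℓ hgD
  have e1 : ∫ ω, F ω * g (M.X (u + ℓ) ω) ∂(M.law μ)
      = ∫ ω, F ω * M.semigroup ℓ g (M.X u ω) ∂(M.law μ) := by
    have h0 : ∀ x, 0 ≤ M.semigroup ℓ g x := fun x => integral_nonneg hg0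
    rw [integral_eq_lintegral_of_nonneg_ae (ae_of_all _ fun ω => mul_nonneg (hF0 ω) (hg0 _))
        (hF'.mul (hgm.comp (M.measurable_X_apply _))).aestronglyMeasurable,
      integral_eq_lintegral_of_nonneg_ae (ae_of_all _ fun ω => mul_nonneg (hF0 ω) (h0 _))
        (hF'.mul (hPm.comp (M.measurable_X_apply _))).aestronglyMeasurable]
    congr 1
    have := M.lintegral_markov μ u ℓ hF.ennreal_ofReal hgm.ennreal_ofReal
    refine Eq.trans (lintegral_congr fun ω => ENNReal.ofReal_mul (hF0 ω)) (this.trans ?_)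
    refine lintegral_congr fun ω => ?_
    rw [ENNReal.ofReal_mul (hF0 ω), M.semigroup_eq_integral_Pr ℓ hgm,
      ofReal_integral_eq_lintegral_ofReal]
    · exact integrable_of_forall_abs_le (hgm.comp (M.measurable_X_apply _)) fun ω' => hgD _
    · exact ae_of_all _ fun ω' => hg0 _
  have hdiff : Measurable fun x => |M.semigroup ℓ g x - ∫ y, g y ∂μ| := (hPm.sub_const _).abs
  have hdb : ∀ x, |M.semigroup ℓ g x - ∫ y, g y ∂μ| ≤ D + D := fun x =>
    (abs_sub _ _).trans (add_le_add (hPb x) (abs_integral_le_of_forall_abs_le hgD))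
  have hFi : Integrable F (M.law μ) := integrable_of_forall_abs_le hF' hFb
  have hdi : Integrable (fun ω => |M.semigroup ℓ g (M.X u ω) - ∫ y, g y ∂μ|) (M.law μ) :=
    integrable_of_forall_abs_le (hdiff.comp (M.measurable_X_apply u)) fun ω => by
      rw [abs_abs]; exact hdb _
  rw [e1]
  -- The mean of `g` multiplies the exact integral of `F`; only the error is charged at the supremum
  -- `L`, since mixing controls it in `L¹` alone.
  calc ∫ ω, F ω * M.semigroup ℓ g (M.X u ω) ∂(M.law μ)
      ≤ ∫ ω, (F ω * (∫ y, g y ∂μ) + L * |M.semigroup ℓ g (M.X u ω) - ∫ y, g y ∂μ|) ∂(M.law μ) := by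
        refine integral_mono ?_ ((hFi.mul_const _).add (hdi.const_mul _)) fun ω => ?_
        · refine integrable_of_forall_abs_le (C := L * D)
            (hF'.mul (hPm.comp (M.measurable_X_apply _))) fun ω => ?_
          rw [abs_mul]
          exact mul_le_mul (hFb ω) (hPb _) (abs_nonneg _) hL0
        · simp only
          have h1 := mul_le_mul_of_nonneg_left
            (le_abs_self (M.semigroup ℓ g (M.X u ω) - ∫ y, g y ∂μ)) (hF0 ω)
          have h2 := mul_le_mul_of_nonneg_right (hFL ω)
            (abs_nonneg (M.semigroup ℓ g (M.X u ω) - ∫ y, g y ∂μ))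
          linarith
    _ = (∫ ω, F ω ∂(M.law μ)) * (∫ y, g y ∂μ)
        + L * ∫ x, |M.semigroup ℓ g x - ∫ y, g y ∂μ| ∂μ := by
        rw [integral_add (hFi.mul_const _) (hdi.const_mul _), integral_mul_const,
          integral_const_mul, M.integral_law_X hμ u hdiff]
    _ ≤ _ := by gcongr; exact hα g D hgm hgK ℓ

/-! ### Covariances and second moments of block sums. -/

theorem abs_integral_mul_le (M : MarkovProcess E Ω) {μ : Measure E} [IsProbabilityMeasure μ]
    (hμ : M.IsInvariant μ) {α : ℝ≥0 → ℝ} (hα : M.IsMixing μ α) (u t : ℝ≥0) {f : E → ℝ}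
    (hf : Measurable f) {K : ℝ} (hK : ∀ x, |f x| ≤ K) (hf0 : ∫ x, f x ∂μ = 0) :
    |∫ ω, f (M.X u ω) * f (M.X (u + t) ω) ∂(M.law μ)| ≤ 2 * α t * K ^ 2 := by
  obtain ⟨x₀⟩ : Nonempty E := nonempty_of_isProbabilityMeasure μ
  have hK0 : 0 ≤ K := (abs_nonneg _).trans (hK x₀)
  rw [M.integral_mul_law_X hμ u t hf hf hK hK]
  have h1 := hα f K hf (by simpa [hf0] using hK) t
  rw [hf0] at h1
  simp only [sub_zero] at h1
  have hPm := M.measurable_semigroup t hf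
  have hPb := M.abs_semigroup_le t hK
  calc |∫ x, f x * M.semigroup t f x ∂μ| ≤ ∫ x, |f x * M.semigroup t f x| ∂μ :=
        abs_integral_le_integral_abs
    _ ≤ ∫ x, K * |M.semigroup t f x| ∂μ := by
        refine integral_mono ?_ ?_ fun x => ?_
        · refine (integrable_of_forall_abs_le (C := K * K) (hf.mul hPm) fun x => ?_).abs
          rw [Pi.mul_apply, abs_mul]
          exact mul_le_mul (hK x) (hPb x) (abs_nonneg _) hK0
        · exact (integrable_of_forall_abs_le hPm hPb).abs.const_mul K
        · simp only
          rw [abs_mul]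
          exact mul_le_mul_of_nonneg_right (hK x) (abs_nonneg _)
    _ = K * ∫ x, |M.semigroup t f x| ∂μ := integral_const_mul _ _
    _ ≤ K * (2 * α t * K) := by gcongr
    _ = _ := by ring

/-- In each row a lag `k` occurs at most twice, once on each side of the diagonal. -/
theorem _root_.Finset.sum_sum_range_le_of_symm {q : ℕ} {a : ℕ → ℕ → ℝ} {b : ℕ → ℝ}
    (hb : ∀ k, 0 ≤ b k) (h₁ : ∀ i k, a i (i + k) ≤ b k) (h₂ : ∀ i k, a (i + k) i ≤ b k) :
    ∑ i ∈ Finset.range q, ∑ j ∈ Finset.range q, a i j ≤ q * (2 * ∑ k ∈ Finset.range q, b k) := by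
  have hrow : ∀ i ∈ Finset.range q,
      ∑ j ∈ Finset.range q, a i j ≤ 2 * ∑ k ∈ Finset.range q, b k := by
    intro i hi
    rw [Finset.mem_range] at hi
    calc ∑ j ∈ Finset.range q, a i j
        ≤ ∑ j ∈ Finset.range q, ∑ k ∈ Finset.range q,
            ((if i + k = j then b k else 0) + (if j + k = i then b k else 0)) := by
          refine Finset.sum_le_sum fun j hj => ?_
          rw [Finset.mem_range] at hj
          have hnn : ∀ k ∈ Finset.range q,
              0 ≤ (if i + k = j then b k else 0) + (if j + k = i then b k else 0) := fun k _ => by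
            have := hb k
            split_ifs <;> linarith
          rcases le_total i j with hij | hij
          · obtain ⟨k, rfl⟩ := Nat.exists_eq_add_of_le hij
            refine le_trans ?_ (Finset.single_le_sum hnn (Finset.mem_range.mpr (by omega : k < q)))
            have := hb k
            have := h₁ i k
            rw [if_pos rfl]
            split_ifs <;> linarith
          · obtain ⟨k, rfl⟩ := Nat.exists_eq_add_of_le hij
            refine le_trans ?_ (Finset.single_le_sum hnn (Finset.mem_range.mpr (by omega : k < q)))
            have := hb k
            have := h₂ j k
            rw [if_pos (rfl : j + k = j + k)]
            split_ifs <;> linarith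
      _ = ∑ k ∈ Finset.range q, ∑ j ∈ Finset.range q,
            ((if i + k = j then b k else 0) + (if j + k = i then b k else 0)) := Finset.sum_comm
      _ ≤ ∑ k ∈ Finset.range q, 2 * b k := by
          refine Finset.sum_le_sum fun k _ => ?_
          rw [Finset.sum_add_distrib, two_mul]
          refine add_le_add ?_ ?_
          · rw [Finset.sum_ite_eq]
            split_ifs
            exacts [le_rfl, hb k]
          · by_cases hk : k ≤ i
            · have : ∀ j, (j + k = i) = (i - k = j) := fun j => by
                apply propext; omega
              simp only [this]
              rw [Finset.sum_ite_eq]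
              split_ifs
              exacts [le_rfl, hb k]
            · rw [Finset.sum_eq_zero]
              · exact hb k
              · intro j _
                rw [if_neg (by omega)]
      _ = _ := by rw [Finset.mul_sum]
  calc _ ≤ ∑ i ∈ Finset.range q, 2 * ∑ k ∈ Finset.range q, b k := Finset.sum_le_sum hrow
    _ = _ := by simp

theorem integral_sq_sum_le (M : MarkovProcess E Ω) {μ : Measure E} [IsProbabilityMeasure μ]
    (hμ : M.IsInvariant μ) {α : ℝ≥0 → ℝ} (hα : M.IsMixing μ α) (hα0 : ∀ s, 0 ≤ α s)
    (v h : ℝ≥0) (q : ℕ) {f : E → ℝ} (hf : Measurable f) {K : ℝ} (hK : ∀ x, |f x| ≤ K)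
    (hf0 : ∫ x, f x ∂μ = 0) :
    ∫ ω, (∑ i : Fin q, f (M.X (v + i * h) ω)) ^ 2 ∂(M.law μ)
      ≤ q * (2 * ∑ k ∈ Finset.range q, 2 * α (k * h) * K ^ 2) := by
  obtain ⟨x₀⟩ : Nonempty E := nonempty_of_isProbabilityMeasure μ
  have hK0 : 0 ≤ K := (abs_nonneg _).trans (hK x₀)
  have hint : ∀ i j : ℕ, Integrable
      (fun ω => f (M.X (v + i * h) ω) * f (M.X (v + j * h) ω)) (M.law μ) := fun i j =>
    integrable_of_forall_abs_le (C := K * K) ((hf.comp (M.measurable_X_apply _)).mul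
      (hf.comp (M.measurable_X_apply _))) fun ω => by
        rw [abs_mul]; exact mul_le_mul (hK _) (hK _) (abs_nonneg _) hK0
  have e : ∀ ω, (∑ i : Fin q, f (M.X (v + i * h) ω)) ^ 2
      = ∑ i ∈ Finset.range q, ∑ j ∈ Finset.range q,
        f (M.X (v + i * h) ω) * f (M.X (v + j * h) ω) := fun ω => by
    rw [Fin.sum_univ_eq_sum_range fun i : ℕ => f (M.X (v + i * h) ω), sq, Finset.sum_mul_sum]
  simp_rw [e]
  rw [integral_finsetSum _ fun i _ => integrable_finsetSum _ fun j _ => hint i j]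
  simp_rw [fun i => integral_finsetSum (Finset.range q) fun j _ => hint i j]
  have hshift : ∀ i k : ℕ, v + ((i + k : ℕ) : ℝ≥0) * h = v + i * h + k * h := fun i k => by
    push_cast; ring
  have hcorr : ∀ i k : ℕ, ∫ ω, f (M.X (v + i * h) ω) * f (M.X (v + (i + k : ℕ) * h) ω) ∂(M.law μ)
      ≤ 2 * α (k * h) * K ^ 2 := fun i k => by
    rw [hshift]
    exact (le_abs_self _).trans (M.abs_integral_mul_le hμ hα _ _ hf hK hf0)
  refine Finset.sum_sum_range_le_of_symm (fun k => ?_) hcorr fun i k => ?_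
  · have := hα0 (k * h)
    positivity
  · refine le_trans (le_of_eq ?_) (hcorr i k)
    exact integral_congr_ae (ae_of_all _ fun ω => mul_comm _ _)

/-- Telescoping: `h/(x+h)² ≤ 1/x - 1/(x+h)`. The bound must not depend on the number of terms. -/
theorem _root_.sum_range_div_sq_le {a h : ℝ} (ha : 0 < a) (hh : 0 ≤ h) (q : ℕ) :
    ∑ k ∈ Finset.range q, h / (a + k * h) ^ 2 ≤ h / a ^ 2 + 1 / a := by
  have key : ∑ k ∈ Finset.range (q + 1), h / (a + k * h) ^ 2
      ≤ h / a ^ 2 + 1 / a - 1 / (a + q * h) := by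
    induction q with
    | zero => simp
    | succ q ih =>
      rw [Finset.sum_range_succ]
      have h1 : 0 < a + q * h := by positivity
      have h2 : h / (a + (q + 1 : ℕ) * h) ^ 2 ≤ 1 / (a + q * h) - 1 / (a + (q + 1 : ℕ) * h) := by
        have h3 : 0 < a + (q + 1 : ℕ) * h := by positivity
        have h4 : a + (q + 1 : ℕ) * h = a + q * h + h := by push_cast; ring
        rw [div_sub_div _ _ h1.ne' h3.ne', div_le_div_iff₀ (by positivity) (by positivity), h4]
        have h5 : 0 ≤ (a + q * h) := h1.le
        have h6 : h * ((a + q * h) * (a + q * h + h)) ≤ h * (a + q * h + h) ^ 2 := by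
          gcongr
          nlinarith
        linarith
      linarith
  have h1 : ∑ k ∈ Finset.range q, h / (a + k * h) ^ 2
      ≤ ∑ k ∈ Finset.range (q + 1), h / (a + k * h) ^ 2 := by
    rw [Finset.sum_range_succ]
    have : 0 ≤ h / (a + q * h) ^ 2 := by positivity
    linarith
  have h2 : 0 ≤ 1 / (a + q * h) := by positivity
  linarith

/-- The second moment of the block average `h ∑ f(X_{v+ih})` when the mixing rate decays
quadratically. -/
theorem integral_sq_block_le (M : MarkovProcess E Ω) {μ : Measure E} [IsProbabilityMeasure μ]
    (hμ : M.IsInvariant μ) {α : ℝ≥0 → ℝ} (hα : M.IsMixing μ α) (hα0 : ∀ s, 0 ≤ α s) {c a : ℝ}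
    (hc : 0 ≤ c) (ha : 0 < a) (hαa : ∀ s : ℝ≥0, α s ≤ c * (4 * a ^ 2 / (a + s) ^ 2))
    (v h : ℝ≥0) (hh : (h : ℝ) ≤ a) (q : ℕ) {f : E → ℝ} (hf : Measurable f) {K : ℝ}
    (hK : ∀ x, |f x| ≤ K) (hf0 : ∫ x, f x ∂μ = 0) :
    ∫ ω, ((h : ℝ) * ∑ i : Fin q, f (M.X (v + i * h) ω)) ^ 2 ∂(M.law μ)
      ≤ 32 * c * K ^ 2 * a * (q * h) := by
  have h1 := M.integral_sq_sum_le hμ hα hα0 v h q hf hK hf0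
  simp_rw [mul_pow]
  rw [integral_const_mul]
  have h2 : (h : ℝ) * ∑ k ∈ Finset.range q, α (k * h) ≤ 8 * c * a := by
    calc (h : ℝ) * ∑ k ∈ Finset.range q, α (k * h)
        ≤ (h : ℝ) * ∑ k ∈ Finset.range q, c * (4 * a ^ 2 / (a + k * h) ^ 2) := by
          gcongr with k hk
          exact_mod_cast hαa (k * h)
      _ = 4 * c * a ^ 2 * ∑ k ∈ Finset.range q, (h : ℝ) / (a + k * h) ^ 2 := by
          rw [Finset.mul_sum, Finset.mul_sum]
          refine Finset.sum_congr rfl fun k _ => ?_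
          ring
      _ ≤ 4 * c * a ^ 2 * (h / a ^ 2 + 1 / a) := by
          gcongr
          exact sum_range_div_sq_le ha h.2 q
      -- The diagonal term is where the mesh condition `h ≤ a` is needed; afterwards the bound no
      -- longer sees `h`.
      _ ≤ 4 * c * a ^ 2 * (a / a ^ 2 + 1 / a) := by gcongr
      _ = 8 * c * a := by field_simp; ring
  calc (h : ℝ) ^ 2 * ∫ ω, (∑ i : Fin q, f (M.X (v + i * h) ω)) ^ 2 ∂(M.law μ)
      ≤ (h : ℝ) ^ 2 * (q * (2 * ∑ k ∈ Finset.range q, 2 * α (k * h) * K ^ 2)) := by gcongr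
    _ = 4 * K ^ 2 * (q * h) * ((h : ℝ) * ∑ k ∈ Finset.range q, α (k * h)) := by
        simp_rw [← Finset.sum_mul, ← Finset.mul_sum]; ring
    _ ≤ 4 * K ^ 2 * (q * h) * (8 * c * a) := by gcongr
    _ = _ := by ring

end MarkovProcess

/-! ### Stopped products of weakly dependent factors. -/

/-- A maximal inequality for products `W_k = ∏_{j<k} Y_j` of nonnegative variables that are nearly
independent, stopped when they exceed the level `L`. -/
theorem MeasureTheory.measureReal_lt_prod_le {Ω : Type*} [MeasurableSpace Ω] {P : Measure Ω}
    [IsProbabilityMeasure P] {Y : ℕ → Ω → ℝ} (hY : ∀ k, Measurable (Y k)) (hY0 : ∀ k ω, 0 ≤ Y k ω)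
    {D : ℝ} (hYD : ∀ k ω, Y k ω ≤ D) {L L' G δ : ℝ} (hL : 1 ≤ L) (hL' : 0 < L') (hG : 1 ≤ G)
    (hδ : 0 ≤ δ)
    (hjump : ∀ k ω, L < ∏ j ∈ Finset.range k, Y j ω → L' ≤ ∏ j ∈ Finset.range k, Y j ω)
    (hdec : ∀ k, ∫ ω, {ω | ∀ i ≤ k, ∏ j ∈ Finset.range i, Y j ω ≤ L}.indicator
          (fun ω => ∏ j ∈ Finset.range k, Y j ω) ω * Y k ω ∂P
        ≤ G * (∫ ω, {ω | ∀ i ≤ k, ∏ j ∈ Finset.range i, Y j ω ≤ L}.indicator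
          (fun ω => ∏ j ∈ Finset.range k, Y j ω) ω ∂P) + L * δ) (N : ℕ) :
    P.real {ω | L < ∏ j ∈ Finset.range N, Y j ω} ≤ G ^ N * (1 + N * (L * δ)) / L' := by
  set W : ℕ → Ω → ℝ := fun k ω => ∏ j ∈ Finset.range k, Y j ω with hW
  set A : ℕ → Set Ω := fun k => {ω | ∀ i ≤ k, W i ω ≤ L} with hA
  have hWm : ∀ k, Measurable (W k) := fun k => Finset.measurable_prod _ fun j _ => hY j
  have hW0 : ∀ k ω, 0 ≤ W k ω := fun k ω => Finset.prod_nonneg fun j _ => hY0 j ω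
  have hAm : ∀ k, MeasurableSet (A k) := fun k => by
    have : A k = ⋂ i ∈ Finset.range (k + 1), {ω | W i ω ≤ L} := by
      ext ω; simp [hA]
    rw [this]
    exact Finset.measurableSet_biInter _ fun i _ => measurableSet_le (hWm i) measurable_const
  set F : ℕ → Ω → ℝ := fun k => (A k).indicator (W k) with hF
  have hFm : ∀ k, Measurable (F k) := fun k => (hWm k).indicator (hAm k)
  have hF0 : ∀ k ω, 0 ≤ F k ω := fun k ω => Set.indicator_nonneg (fun ω _ => hW0 k ω) ω
  have hFL : ∀ k ω, F k ω ≤ L := fun k ω => by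
    by_cases h : ω ∈ A k
    · simp only [hF, Set.indicator_of_mem h]; exact h k le_rfl
    · simp only [hF, Set.indicator_of_notMem h]; linarith
  -- `U k` is the stopped product with its value after exceeding `L` replaced by the constant `L'`.
  -- By `hjump` the product is at least `L'` at the exit, so this replacement only lowers it, and `E
  -- U_{k+1} ≤ G·E U_k + Lδ`.
  set U : ℕ → Ω → ℝ := fun k ω => L' * (A k)ᶜ.indicator 1 ω + F k ω with hU
  have hIm : ∀ k, Measurable ((A k)ᶜ.indicator (1 : Ω → ℝ)) := fun k =>
    measurable_one.indicator (hAm k).compl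
  have hFi : ∀ k, Integrable (F k) P := fun k => integrable_of_forall_abs_le (hFm k) (C := L)
    fun ω => by rw [abs_of_nonneg (hF0 k ω)]; exact hFL k ω
  have hIi : ∀ k, Integrable (fun ω => L' * (A k)ᶜ.indicator (1 : Ω → ℝ) ω) P := fun k =>
    ((integrable_const (1 : ℝ)).indicator (hAm k).compl).const_mul L'
  have hFYi : ∀ k, Integrable (fun ω => F k ω * Y k ω) P := fun k =>
    integrable_of_forall_abs_le ((hFm k).mul (hY k)) (C := L * D) fun ω => by
      rw [abs_of_nonneg (mul_nonneg (hF0 k ω) (hY0 k ω))]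
      exact mul_le_mul (hFL k ω) (hYD k ω) (hY0 k ω) (by linarith)
  have hUi : ∀ k, Integrable (U k) P := fun k => (hIi k).add (hFi k)
  have step : ∀ k ω, U (k + 1) ω ≤ L' * (A k)ᶜ.indicator 1 ω + F k ω * Y k ω := by
    intro k ω
    have hsucc : W (k + 1) ω = W k ω * Y k ω := Finset.prod_range_succ _ _
    by_cases h : ω ∈ A k
    · by_cases h' : ω ∈ A (k + 1)
      · simp [hU, hF, h, h', hsucc]
      · have : L < W (k + 1) ω := by
          by_contra hle
          refine h' fun i hi => ?_
          rcases Nat.le_succ_iff.mp hi with hi | rfl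
          exacts [h i hi, not_lt.mp hle]
        have := hjump _ _ this
        simp only [hU, hF, Set.indicator_of_mem (show ω ∈ (A (k + 1))ᶜ from h'),
          Set.indicator_of_notMem h', Set.indicator_of_mem h,
          Set.indicator_of_notMem (show ω ∉ (A k)ᶜ from fun hh => hh h), Pi.one_apply]
        rw [← hsucc]
        linarith
    · have h' : ω ∉ A (k + 1) := fun hh => h fun i hi => hh i (hi.trans k.le_succ)
      simp [hU, hF, h, h']
  have hEU : ∀ k, ∫ ω, U k ω ∂P ≤ G ^ k * (1 + k * (L * δ)) := by
    intro k
    induction k with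
    | zero =>
      have : ∀ ω, U 0 ω = 1 := fun ω => by
        have h : ω ∈ A 0 := fun i hi => by
          rw [Nat.le_zero.mp hi]; simpa [hW] using hL
        simp [hU, hF, h, hW]
      simp [this]
    | succ k ih =>
      have h1 : ∫ ω, U (k + 1) ω ∂P
          ≤ ∫ ω, (L' * (A k)ᶜ.indicator 1 ω + F k ω * Y k ω) ∂P :=
        integral_mono (hUi _) ((hIi k).add (hFYi k)) (step k)
      have h2 : ∫ ω, U k ω ∂P = ∫ ω, L' * (A k)ᶜ.indicator 1 ω ∂P + ∫ ω, F k ω ∂P :=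
        integral_add (hIi k) (hFi k)
      rw [integral_add (hIi k) (hFYi k)] at h1
      have h3 : 0 ≤ ∫ ω, L' * (A k)ᶜ.indicator (1 : Ω → ℝ) ω ∂P :=
        integral_nonneg fun ω => mul_nonneg hL'.le (Set.indicator_nonneg (by simp) _)
      have h4 := hdec k
      have h5 : 0 ≤ L * δ := by positivity
      have h6 : 1 ≤ G ^ (k + 1) := one_le_pow₀ hG
      calc ∫ ω, U (k + 1) ω ∂P
          ≤ G * ∫ ω, U k ω ∂P + L * δ := by
            rw [h2]
            have := le_mul_of_one_le_left h3 hG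
            rw [mul_add]
            linarith
        _ ≤ G * (G ^ k * (1 + k * (L * δ))) + G ^ (k + 1) * (L * δ) := by
            have := le_mul_of_one_le_left h5 h6
            gcongr
        _ = _ := by push_cast; ring
  have hmark : L' * P.real {ω | L < W N ω} ≤ ∫ ω, U N ω ∂P := by
    have hBm : MeasurableSet {ω | L < W N ω} := measurableSet_lt measurable_const (hWm N)
    have : ∫ ω, {ω | L < W N ω}.indicator (fun _ => L') ω ∂P = L' * P.real {ω | L < W N ω} := by
      rw [integral_indicator hBm, setIntegral_const, smul_eq_mul, mul_comm]
    rw [← this]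
    refine integral_mono ((integrable_const L').indicator hBm) (hUi N) fun ω => ?_
    by_cases h : L < W N ω
    · have h' : ω ∉ A N := fun hh => absurd (hh N le_rfl) (not_le.mpr h)
      have h'' : ω ∈ {ω | L < W N ω} := h
      simp [hU, hF, h', h'']
    · have h'' : ω ∉ {ω | L < W N ω} := h
      rw [Set.indicator_of_notMem h'']
      exact add_nonneg (mul_nonneg hL'.le (Set.indicator_nonneg (by simp) _)) (hF0 _ _)
  rw [le_div_iff₀ hL', mul_comm]
  exact hmark.trans (hEU N)

namespace MarkovProcess

variable {E Ω : Type*} [MeasurableSpace E] [MeasurableSpace Ω]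

/-- Blocks of length `ℓ = qh` start every `2ℓ`, so the stopped product of the first `k + 1` blocks
belongs to the past of a time that precedes the next block by a gap `ℓ`. -/
theorem measureReal_lt_prod_block_le (M : MarkovProcess E Ω) {μ : Measure E}
    [IsProbabilityMeasure μ] (hμ : M.IsInvariant μ) {α : ℝ≥0 → ℝ} (hα : M.IsMixing μ α)
    (hα0 : ∀ s, 0 ≤ α s) (r h : ℝ≥0) (q : ℕ) {Ψ : (Fin q → E) → ℝ} (hΨ : Measurable Ψ)
    (hΨ0 : ∀ z, 0 ≤ Ψ z) {D : ℝ} (hΨD : ∀ z, Ψ z ≤ D) {L L' G : ℝ} (hL : 1 ≤ L) (hL' : 0 < L')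
    (hG : 1 ≤ G) (hΨG : ∫ ω, Ψ (fun i => M.X (r + i * h) ω) ∂(M.law μ) ≤ G)
    (hjump : ∀ k ω, L < ∏ j ∈ Finset.range k, Ψ (fun i => M.X (r + j * (2 * (q * h)) + i * h) ω) →
      L' ≤ ∏ j ∈ Finset.range k, Ψ (fun i => M.X (r + j * (2 * (q * h)) + i * h) ω)) (N : ℕ) :
    (M.law μ).real
        {ω | L < ∏ j ∈ Finset.range N, Ψ (fun i => M.X (r + j * (2 * (q * h)) + i * h) ω)}
      ≤ G ^ N * (1 + N * (L * (2 * α (q * h) * D))) / L' := by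
  obtain ⟨ω₀⟩ : Nonempty Ω := nonempty_of_isProbabilityMeasure (M.law μ)
  have hD0 : 0 ≤ D := (hΨ0 _).trans (hΨD fun i => M.X 0 ω₀)
  set ℓ : ℝ≥0 := q * h with hℓ
  have hYm : ∀ k : ℕ, Measurable fun ω => Ψ (fun i => M.X (r + k * (2 * ℓ) + i * h) ω) :=
    fun k => hΨ.comp (M.measurable_path _ h q)
  have hpast : ∀ k : ℕ, Measurable[M.past (r + k * (2 * ℓ) + ℓ)]
      fun ω => Ψ (fun i => M.X (r + k * (2 * ℓ) + i * h) ω) := fun k => by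
    refine hΨ.comp (@measurable_pi_lambda _ _ _ (M.past _) _ _ fun i => M.measurable_X_past ?_)
    have : (i : ℝ≥0) ≤ q := by exact_mod_cast i.2.le
    rw [hℓ]
    gcongr
  refine measureReal_lt_prod_le (Y := fun k ω => Ψ (fun i => M.X (r + k * (2 * ℓ) + i * h) ω))
    hYm (fun k ω => hΨ0 _) (D := D) (fun k ω => hΨD _) hL hL' hG
    (by have := hα0 ℓ; positivity) hjump (fun k => ?_) N
  have hstat : ∫ x, ∫ ω', Ψ (fun i => M.X (0 + i * h) ω') ∂(M.Pr x) ∂μ ≤ G := by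
    rwa [← M.integral_path_stationary hμ r h q hΨ hΨ0 hΨD]
  -- The first block has no past; its factor is bounded by the moment hypothesis directly.
  rcases k with _ | k
  · have h1 : ∀ ω, {ω | ∀ i ≤ 0, ∏ j ∈ Finset.range i,
        Ψ (fun i => M.X (r + j * (2 * ℓ) + i * h) ω) ≤ L}.indicator
          (fun ω => ∏ j ∈ Finset.range 0, Ψ (fun i => M.X (r + j * (2 * ℓ) + i * h) ω)) ω = 1 := by
      intro ω
      rw [Set.indicator_of_mem]
      · simp
      · intro i hi
        rw [Nat.le_zero.mp hi]
        simpa using hL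
    simp_rw [h1]
    have : 0 ≤ L * (2 * α ℓ * D) := by have := hα0 ℓ; positivity
    simp only [one_mul, Nat.cast_zero, zero_mul, add_zero, integral_const, probReal_univ, smul_eq_mul,
      mul_one]
    linarith
  · set A := {ω | ∀ i ≤ k + 1, ∏ j ∈ Finset.range i,
        Ψ (fun i => M.X (r + j * (2 * ℓ) + i * h) ω) ≤ L} with hA
    have hWm : ∀ i ≤ k + 1, Measurable[M.past (r + k * (2 * ℓ) + ℓ)] fun ω =>
        ∏ j ∈ Finset.range i, Ψ (fun i => M.X (r + j * (2 * ℓ) + i * h) ω) := fun i hi => by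
      refine Finset.measurable_prod _ fun j hj => (hpast j).mono (M.past_mono ?_) le_rfl
      have hjk : (j : ℝ≥0) ≤ k := by
        have := Finset.mem_range.mp hj
        exact_mod_cast (by omega : j ≤ k)
      gcongr
    have hAm : MeasurableSet[M.past (r + k * (2 * ℓ) + ℓ)] A := by
      have : A = ⋂ i ∈ Finset.range (k + 1 + 1), {ω | ∏ j ∈ Finset.range i,
          Ψ (fun i => M.X (r + j * (2 * ℓ) + i * h) ω) ≤ L} := by
        ext ω; simp [hA]
      rw [this]
      refine Finset.measurableSet_biInter _ fun i hi => ?_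
      exact @measurableSet_le _ _ _ _ _ (M.past _) _ _ _ _ _
        (hWm i (by have := Finset.mem_range.mp hi; omega)) measurable_const
    have hF : Measurable[M.past (r + k * (2 * ℓ) + ℓ)] (A.indicator fun ω =>
        ∏ j ∈ Finset.range (k + 1), Ψ (fun i => M.X (r + j * (2 * ℓ) + i * h) ω)) :=
      (hWm (k + 1) le_rfl).indicator hAm
    have hF0 : ∀ ω, 0 ≤ A.indicator (fun ω =>
        ∏ j ∈ Finset.range (k + 1), Ψ (fun i => M.X (r + j * (2 * ℓ) + i * h) ω)) ω := fun ω =>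
      Set.indicator_nonneg (fun ω _ => Finset.prod_nonneg fun j _ => hΨ0 _) ω
    have hFL : ∀ ω, A.indicator (fun ω =>
        ∏ j ∈ Finset.range (k + 1), Ψ (fun i => M.X (r + j * (2 * ℓ) + i * h) ω)) ω ≤ L :=
      fun ω => by
        by_cases hω : ω ∈ A
        · rw [Set.indicator_of_mem hω]; exact hω _ le_rfl
        · rw [Set.indicator_of_notMem hω]; linarith
    have key := M.integral_mul_path_le hμ hα (r + k * (2 * ℓ) + ℓ) ℓ h q hF hF0 hFL hΨ hΨ0 hΨD
    have e : r + k * (2 * ℓ) + ℓ + ℓ = r + (k + 1 : ℕ) * (2 * ℓ) := by push_cast; ring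
    rw [e] at key
    refine key.trans ?_
    rw [mul_comm G]
    exact add_le_add (mul_le_mul_of_nonneg_left hstat (integral_nonneg fun ω => hF0 ω)) le_rfl

/-! ### Tail bounds for sums over separated blocks. -/

/-- The contribution `h ∑_{i<q} f(X_{v+ih})` of a block of length `qh` to a Riemann sum. -/
noncomputable def block (M : MarkovProcess E Ω) (f : E → ℝ) (h : ℝ≥0) (q : ℕ) (v : ℝ≥0) (ω : Ω) : ℝ :=
  h * ∑ i : Fin q, f (M.X (v + i * h) ω)

theorem measurable_block (M : MarkovProcess E Ω) {f : E → ℝ} (hf : Measurable f) (h : ℝ≥0) (q : ℕ)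
    (v : ℝ≥0) : Measurable (M.block f h q v) :=
  (Finset.measurable_sum _ fun _ _ => hf.comp (M.measurable_X_apply _)).const_mul _

theorem _root_.abs_mul_sum_le {E : Type*} {f : E → ℝ} {K : ℝ} (hK : ∀ x, |f x| ≤ K) (h : ℝ≥0) (q : ℕ)
    (z : Fin q → E) : |(h : ℝ) * ∑ i, f (z i)| ≤ K * (q * h) := by
  rw [abs_mul, abs_of_nonneg h.coe_nonneg]
  calc (h : ℝ) * |∑ i, f (z i)| ≤ h * ∑ i : Fin q, K := by
        gcongr
        exact (Finset.abs_sum_le_sum_abs _ _).trans (Finset.sum_le_sum fun i _ => hK _)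
    _ = K * (q * h) := by simp; ring

theorem abs_block_le (M : MarkovProcess E Ω) {f : E → ℝ} {K : ℝ} (hK : ∀ x, |f x| ≤ K) (h : ℝ≥0)
    (q : ℕ) (v : ℝ≥0) (ω : Ω) : |M.block f h q v ω| ≤ K * (q * h) :=
  abs_mul_sum_le hK h q _

theorem integral_block (M : MarkovProcess E Ω) {μ : Measure E} [IsProbabilityMeasure μ]
    (hμ : M.IsInvariant μ) {f : E → ℝ} (hf : Measurable f) {K : ℝ} (hK : ∀ x, |f x| ≤ K)
    (hf0 : ∫ x, f x ∂μ = 0) (h : ℝ≥0) (q : ℕ) (v : ℝ≥0) :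
    ∫ ω, M.block f h q v ω ∂(M.law μ) = 0 := by
  simp only [block]
  have hi : ∀ i : Fin q, Integrable (fun ω => f (M.X (v + i * h) ω)) (M.law μ) := fun i =>
    integrable_of_forall_abs_le (hf.comp (M.measurable_X_apply _)) fun ω => hK _
  rw [integral_const_mul, integral_finsetSum _ fun i _ => hi i]
  simp [M.integral_law_X hμ _ hf, hf0]

/-- Each block with sum above `κ` carries weight `e^b` and every other block weight `1`; Chebyshev
bounds the mean weight. The product takes only the values `e^{bj}`, so exceeding `L = e^{b(k-1)}`
forces it to reach `L' = e^{bk}`. The ratio `L/L'` cancels the supremum `e^b` of a factor, so the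
mixing error `2Nα` is free of `b`. -/
theorem measureReal_card_block_le (M : MarkovProcess E Ω) {μ : Measure E}
    [IsProbabilityMeasure μ] (hμ : M.IsInvariant μ) {α : ℝ≥0 → ℝ} (hα : M.IsMixing μ α)
    (hα0 : ∀ s, 0 ≤ α s) (r h : ℝ≥0) (q : ℕ) {f : E → ℝ} (hf : Measurable f) {K : ℝ}
    (hK : ∀ x, |f x| ≤ K) {v : ℝ}
    (hv : ∫ ω, M.block f h q r ω ^ 2 ∂(M.law μ) ≤ v) {κ b : ℝ} (hκ : 0 < κ) (hb : 0 < b) {k : ℕ}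
    (hk : 1 ≤ k) (N : ℕ) :
    (M.law μ).real {ω | k ≤ ((Finset.range N).filter
        fun j : ℕ => κ < M.block f h q (r + j * (2 * (q * h))) ω).card}
      ≤ (1 + Real.exp b * (v / κ ^ 2)) ^ N * (Real.exp (-(b * k)) + 2 * N * α (q * h)) := by
  classical
  let Ψ : (Fin q → E) → ℝ := fun z => if κ < (h : ℝ) * ∑ i, f (z i) then Real.exp b else 1
  have hsum : Measurable fun z : Fin q → E => (h : ℝ) * ∑ i, f (z i) :=
    (Finset.measurable_sum _ fun i _ => hf.comp (measurable_pi_apply i)).const_mul _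
  have hΨ : Measurable Ψ :=
    Measurable.ite (measurableSet_lt measurable_const hsum) measurable_const measurable_const
  have heb : 1 ≤ Real.exp b := Real.one_le_exp hb.le
  have hΨ0 : ∀ z, 0 ≤ Ψ z := fun z => by simp only [Ψ]; split_ifs <;> positivity
  have hΨD : ∀ z, Ψ z ≤ Real.exp b := fun z => by
    simp only [Ψ]; split_ifs
    exacts [le_rfl, heb]
  have hprod : ∀ (n : ℕ) ω, ∏ j ∈ Finset.range n, Ψ (fun i => M.X (r + j * (2 * (q * h)) + i * h) ω)
      = Real.exp (b * ((Finset.range n).filter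
        fun j : ℕ => κ < M.block f h q (r + j * (2 * (q * h))) ω).card) := fun n ω => by
    simp only [Ψ]
    rw [Finset.prod_ite, Finset.prod_const, Finset.prod_const_one, mul_one, ← Real.exp_nat_mul,
      mul_comm]
    rfl
  have hBi : Integrable (fun ω => M.block f h q r ω ^ 2) (M.law μ) :=
    integrable_of_forall_abs_le (C := (K * (q * h)) ^ 2) ((M.measurable_block hf h q r).pow_const 2)
      fun ω => by rw [abs_pow]; gcongr; exact M.abs_block_le hK h q r ω
  have hG : ∫ ω, Ψ (fun i => M.X (r + i * h) ω) ∂(M.law μ) ≤ 1 + Real.exp b * (v / κ ^ 2) := by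
    calc ∫ ω, Ψ (fun i => M.X (r + i * h) ω) ∂(M.law μ)
        ≤ ∫ ω, (1 + Real.exp b / κ ^ 2 * M.block f h q r ω ^ 2) ∂(M.law μ) := by
          refine integral_mono ?_ ((integrable_const _).add (hBi.const_mul _)) fun ω => ?_
          · exact integrable_of_forall_abs_le (hΨ.comp (M.measurable_path r h q))
              fun ω => by rw [abs_of_nonneg (hΨ0 _)]; exact hΨD _
          · simp only [Ψ]
            split_ifs with hω
            · have h1 : κ ^ 2 ≤ M.block f h q r ω ^ 2 := by
                have : κ ≤ M.block f h q r ω := hω.le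
                gcongr
              have h2 : 1 ≤ M.block f h q r ω ^ 2 / κ ^ 2 := by
                rwa [one_le_div (by positivity)]
              calc Real.exp b ≤ Real.exp b * (M.block f h q r ω ^ 2 / κ ^ 2) :=
                    le_mul_of_one_le_right (by positivity) h2
                _ = Real.exp b / κ ^ 2 * M.block f h q r ω ^ 2 := by ring
                _ ≤ _ := by linarith
            · have : 0 ≤ Real.exp b / κ ^ 2 * M.block f h q r ω ^ 2 := by positivity
              linarith
      _ = 1 + Real.exp b / κ ^ 2 * ∫ ω, M.block f h q r ω ^ 2 ∂(M.law μ) := by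
          rw [integral_add (integrable_const _) (hBi.const_mul _), integral_const_mul]
          simp
      _ ≤ 1 + Real.exp b / κ ^ 2 * v := by gcongr
      _ = _ := by ring
  have hv0 : 0 ≤ v := (integral_nonneg fun ω => sq_nonneg _).trans hv
  have hkr : (1 : ℝ) ≤ k := by exact_mod_cast hk
  have key := M.measureReal_lt_prod_block_le hμ hα hα0 r h q hΨ hΨ0 hΨD
    (L := Real.exp (b * (k - 1))) (L' := Real.exp (b * k)) (G := 1 + Real.exp b * (v / κ ^ 2))
    (Real.one_le_exp (mul_nonneg hb.le (by linarith))) (Real.exp_pos _)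
    (le_add_of_nonneg_right (by positivity)) hG
    (fun n ω hn => by
      rw [hprod, Real.exp_lt_exp, mul_lt_mul_iff_right₀ hb] at hn
      rw [hprod, Real.exp_le_exp]
      have : k ≤ ((Finset.range n).filter
        fun j : ℕ => κ < M.block f h q (r + j * (2 * (q * h))) ω).card := by
        have h1 : (k : ℝ) < (((Finset.range n).filter
          fun j : ℕ => κ < M.block f h q (r + j * (2 * (q * h))) ω).card : ℝ) + 1 := by linarith
        exact Nat.lt_succ_iff.mp (by exact_mod_cast h1)
      gcongr) N
  have hset : {ω | k ≤ ((Finset.range N).filter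
        fun j : ℕ => κ < M.block f h q (r + j * (2 * (q * h))) ω).card}
      ⊆ {ω | Real.exp (b * (k - 1)) < ∏ j ∈ Finset.range N,
        Ψ (fun i => M.X (r + j * (2 * (q * h)) + i * h) ω)} := fun ω hω => by
    simp only [Set.mem_ofPred_eq] at hω ⊢
    rw [hprod, Real.exp_lt_exp, mul_lt_mul_iff_right₀ hb]
    have : (k : ℝ) ≤ (((Finset.range N).filter
      fun j : ℕ => κ < M.block f h q (r + j * (2 * (q * h))) ω).card : ℝ) := by exact_mod_cast hω
    linarith
  refine (measureReal_mono hset).trans (key.trans (le_of_eq ?_))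
  rw [mul_div_assoc]
  congr 1
  rw [Real.exp_neg, mul_sub, mul_one, Real.exp_sub]
  field_simp

/-- For `|y| ≤ 1`, `e^y ≤ 1 + y + y²`, a polynomial whose mean needs only the vanishing first moment
and the second moment `v`. It is at most `3`, whence the error `2·3·Nα`. -/
theorem measureReal_lt_sum_block_le (M : MarkovProcess E Ω) {μ : Measure E}
    [IsProbabilityMeasure μ] (hμ : M.IsInvariant μ) {α : ℝ≥0 → ℝ} (hα : M.IsMixing μ α)
    (hα0 : ∀ s, 0 ≤ α s) (r h : ℝ≥0) (q : ℕ) {f : E → ℝ} (hf : Measurable f) {K : ℝ}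
    (hK : ∀ x, |f x| ≤ K) (hf0 : ∫ x, f x ∂μ = 0) {v : ℝ}
    (hv : ∫ ω, M.block f h q r ω ^ 2 ∂(M.law μ) ≤ v) {a x : ℝ} (ha : 0 ≤ a)
    (haK : a * (K * (q * h)) ≤ 1) (hx : 0 ≤ x) (N : ℕ) :
    (M.law μ).real {ω | x < a * ∑ j ∈ Finset.range N, M.block f h q (r + j * (2 * (q * h))) ω}
      ≤ (1 + a ^ 2 * v) ^ N * (Real.exp (-x) + 6 * N * α (q * h)) := by
  let y : (Fin q → E) → ℝ := fun z => a * ((h : ℝ) * ∑ i, f (z i))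
  let Ψ : (Fin q → E) → ℝ := fun z => 1 + y z + y z ^ 2
  have hy : Measurable y :=
    ((Finset.measurable_sum _ fun i _ => hf.comp (measurable_pi_apply i)).const_mul _).const_mul _
  have hy1 : ∀ z, |y z| ≤ 1 := fun z => by
    simp only [y]
    rw [abs_mul, abs_of_nonneg ha]
    exact (mul_le_mul_of_nonneg_left (abs_mul_sum_le hK h q z) ha).trans haK
  have hΨ : Measurable Ψ := (measurable_const.add hy).add (hy.pow_const 2)
  have hΨ0 : ∀ z, 0 ≤ Ψ z := fun z => by
    simp only [Ψ]; nlinarith [sq_nonneg (y z + 1 / 2)]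
  have hΨD : ∀ z, Ψ z ≤ 3 := fun z => by
    have := abs_le.mp (hy1 z)
    simp only [Ψ]; nlinarith
  have hexp : ∀ z, Real.exp (y z) ≤ Ψ z := fun z => by
    have := abs_le.mp (Real.abs_exp_sub_one_sub_id_le (hy1 z))
    simp only [Ψ]; linarith
  have hBm := M.measurable_block hf h q r
  have hBi : Integrable (M.block f h q r) (M.law μ) :=
    integrable_of_forall_abs_le hBm fun ω => M.abs_block_le hK h q r ω
  have hB2i : Integrable (fun ω => M.block f h q r ω ^ 2) (M.law μ) :=
    integrable_of_forall_abs_le (C := (K * (q * h)) ^ 2) (hBm.pow_const 2)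
      fun ω => by rw [abs_pow]; gcongr; exact M.abs_block_le hK h q r ω
  have hG : ∫ ω, Ψ (fun i => M.X (r + i * h) ω) ∂(M.law μ) ≤ 1 + a ^ 2 * v := by
    have e : ∀ ω, Ψ (fun i => M.X (r + i * h) ω)
        = 1 + a * M.block f h q r ω + a ^ 2 * M.block f h q r ω ^ 2 := fun ω => by
      simp only [Ψ, y, block]; ring
    simp_rw [e]
    have h1 : Integrable (fun ω => 1 + a * M.block f h q r ω) (M.law μ) :=
      (integrable_const _).add (hBi.const_mul _)
    rw [integral_add h1 (hB2i.const_mul _), integral_add (integrable_const _) (hBi.const_mul _), integral_const_mul, integral_const_mul,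
      M.integral_block hμ hf hK hf0]
    simp only [integral_const, probReal_univ, smul_eq_mul, mul_one, mul_zero, add_zero]
    gcongr
  have hv0 : 0 ≤ v := (integral_nonneg fun ω => sq_nonneg _).trans hv
  have key := M.measureReal_lt_prod_block_le hμ hα hα0 r h q hΨ hΨ0 hΨD
    (L := Real.exp x) (L' := Real.exp x) (G := 1 + a ^ 2 * v)
    (Real.one_le_exp hx) (Real.exp_pos _) (le_add_of_nonneg_right (by positivity)) hG
    (fun n ω hn => hn.le) N
  have hset : {ω | x < a * ∑ j ∈ Finset.range N, M.block f h q (r + j * (2 * (q * h))) ω}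
      ⊆ {ω | Real.exp x < ∏ j ∈ Finset.range N,
        Ψ (fun i => M.X (r + j * (2 * (q * h)) + i * h) ω)} := fun ω hω => by
    simp only [Set.mem_ofPred_eq] at hω ⊢
    calc Real.exp x < Real.exp (a * ∑ j ∈ Finset.range N,
          M.block f h q (r + j * (2 * (q * h))) ω) := Real.exp_lt_exp.mpr hω
      _ = ∏ j ∈ Finset.range N, Real.exp (y fun i => M.X (r + j * (2 * (q * h)) + i * h) ω) := by
          rw [Finset.mul_sum, Real.exp_sum]; rfl
      _ ≤ _ := Finset.prod_le_prod (fun j _ => (Real.exp_pos _).le) fun j _ => hexp _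
  refine (measureReal_mono hset).trans (key.trans (le_of_eq ?_))
  rw [mul_div_assoc]
  congr 1
  rw [Real.exp_neg]
  field_simp
  ring

/-! ### From blocks to Riemann sums and to the time integral. -/

theorem sum_block_parity (M : MarkovProcess E Ω) (f : E → ℝ) (r h : ℝ≥0) (q N : ℕ) (ω : Ω) :
    (h : ℝ) * ∑ i ∈ Finset.range (2 * N * q), f (M.X (r + i * h) ω)
      = ∑ j ∈ Finset.range N, M.block f h q (r + j * (2 * (q * h))) ω
        + ∑ j ∈ Finset.range N, M.block f h q (r + q * h + j * (2 * (q * h))) ω := by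
  induction N with
  | zero => simp
  | succ N ih =>
    have e : 2 * (N + 1) * q = 2 * N * q + (q + q) := by ring
    have e1 : ∀ i : ℕ, r + N * (2 * (q * h)) + i * h = r + (2 * N * q + i : ℕ) * h := fun i => by
      push_cast; ring
    have e2 : ∀ i : ℕ, r + q * h + N * (2 * (q * h)) + i * h
        = r + (2 * N * q + (q + i) : ℕ) * h := fun i => by
      push_cast; ring
    rw [e, Finset.sum_range_add, Finset.sum_range_add, mul_add, ih, Finset.sum_range_succ,
      Finset.sum_range_succ]
    simp only [block, e1, e2]
    rw [Fin.sum_univ_eq_sum_range (fun i => f (M.X (r + (2 * N * q + i : ℕ) * h) ω)),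
      Fin.sum_univ_eq_sum_range (fun i => f (M.X (r + (2 * N * q + (q + i) : ℕ) * h) ω))]
    ring

theorem measureReal_riemann_le_of_parity (M : MarkovProcess E Ω) {μ : Measure E}
    [IsProbabilityMeasure μ] {f : E → ℝ} {h : ℝ≥0} {q N : ℕ} {x β : ℝ}
    (H : ∀ r : ℝ≥0, (M.law μ).real
      {ω | x / 2 ≤ ∑ j ∈ Finset.range N, M.block f h q (r + j * (2 * (q * h))) ω} ≤ β) (r : ℝ≥0) :
    (M.law μ).real {ω | x ≤ (h : ℝ) * ∑ i ∈ Finset.range (2 * N * q), f (M.X (r + i * h) ω)}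
      ≤ 2 * β := by
  have hsub : {ω | x ≤ (h : ℝ) * ∑ i ∈ Finset.range (2 * N * q), f (M.X (r + i * h) ω)}
      ⊆ {ω | x / 2 ≤ ∑ j ∈ Finset.range N, M.block f h q (r + j * (2 * (q * h))) ω}
        ∪ {ω | x / 2 ≤ ∑ j ∈ Finset.range N, M.block f h q (r + q * h + j * (2 * (q * h))) ω} := by
    intro ω hω
    rw [Set.mem_ofPred_eq, M.sum_block_parity] at hω
    by_contra hcon
    simp only [Set.mem_union, Set.mem_ofPred_eq, not_or, not_le] at hcon
    linarith [hcon.1, hcon.2]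
  calc _ ≤ _ := measureReal_mono hsub
    _ ≤ _ := measureReal_union_le _ _
    _ ≤ β + β := add_le_add (H r) (H (r + q * h))
    _ = 2 * β := by ring

theorem _root_.intervalIntegrable_of_forall_abs_le {g : ℝ → ℝ} (hg : Measurable g) {C : ℝ}
    (hC : ∀ s, |g s| ≤ C) (a b : ℝ) : IntervalIntegrable g volume a b := by
  rw [intervalIntegrable_iff, Set.uIoc]
  exact integrable_of_forall_abs_le hg hC

theorem measurable_path_real (M : MarkovProcess E Ω) {f : E → ℝ} (hf : Measurable f) (ω : Ω) :
    Measurable fun s : ℝ => f (M.X s.toNNReal ω) :=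
  hf.comp (M.measurable_X.comp (measurable_real_toNNReal.prodMk measurable_const))

theorem intervalIntegrable_path (M : MarkovProcess E Ω) {f : E → ℝ} (hf : Measurable f) {K : ℝ}
    (hK : ∀ x, |f x| ≤ K) (ω : Ω) (a b : ℝ) :
    IntervalIntegrable (fun s : ℝ => f (M.X s.toNNReal ω)) volume a b :=
  intervalIntegrable_of_forall_abs_le (M.measurable_path_real hf ω) (fun _ => hK _) a b

/-- Splitting at the multiples of `h` and shifting each piece to `[0,h]` gives an exact identity for
every mesh, so neither path regularity nor a limit `h → 0` is needed. -/
theorem integral_path_eq (M : MarkovProcess E Ω) {f : E → ℝ} (hf : Measurable f) {K : ℝ}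
    (hK : ∀ x, |f x| ≤ K) (h : ℝ≥0) (n : ℕ) (ω : Ω) :
    ∫ s in (0 : ℝ)..(n * h), f (M.X s.toNNReal ω)
      = ∫ r in (0 : ℝ)..h, ∑ i ∈ Finset.range n, f (M.X (r.toNNReal + i * h) ω) := by
  have h1 := intervalIntegral.sum_integral_adjacent_intervals (a := fun i : ℕ => (i : ℝ) * h)
    (f := fun s : ℝ => f (M.X s.toNNReal ω)) (n := n) (μ := volume)
    fun i _ => M.intervalIntegrable_path hf hK ω _ _
  simp only [Nat.cast_zero, zero_mul] at h1
  have h2 : ∀ i : ℕ, Measurable fun r : ℝ => f (M.X (r.toNNReal + i * h) ω) := fun i =>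
    hf.comp (M.measurable_X.comp ((measurable_real_toNNReal.add_const _).prodMk measurable_const))
  rw [← h1, intervalIntegral.integral_finsetSum]
  · refine Finset.sum_congr rfl fun i _ => ?_
    have h3 := intervalIntegral.integral_comp_add_right (a := 0) (b := h)
      (fun s : ℝ => f (M.X s.toNNReal ω)) ((i : ℝ) * h)
    rw [zero_add] at h3
    have h4 : ((i + 1 : ℕ) : ℝ) * h = h + i * h := by push_cast; ring
    rw [h4, ← h3]
    refine intervalIntegral.integral_congr fun r hr => ?_
    rw [Set.uIcc_of_le h.coe_nonneg] at hr
    have : (r + i * h).toNNReal = r.toNNReal + i * h := by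
      rw [Real.toNNReal_add hr.1 (by positivity)]
      congr 1
      rw [← NNReal.coe_natCast, ← NNReal.coe_mul, Real.toNNReal_coe]
    simp only [this]
  · exact fun i _ => intervalIntegrable_of_forall_abs_le (h2 i) (fun _ => hK _) _ _

/-- A bound for the mean excess of `S r` over a level, uniform in `r`, gives a tail bound for the
average of `S r` over `r`. -/
theorem _root_.MeasureTheory.measureReal_le_integral_le {Ω : Type*} [MeasurableSpace Ω]
    {P : Measure Ω} [IsProbabilityMeasure P] {S : ℝ → Ω → ℝ} (hS : Measurable (Function.uncurry S))
    {C : ℝ} (hC : ∀ r ω, |S r ω| ≤ C) {h x ε : ℝ} (hh : 0 < h) (hx : 0 < x)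
    (H : ∀ r, ∫ ω, max (S r ω - x / 2) 0 ∂P ≤ ε) :
    P.real {ω | x * h ≤ ∫ r in (0 : ℝ)..h, S r ω} ≤ 2 / x * ε := by
  -- If the average of `S r` reaches `x`, then the average of its excess over `x/2` is at least
  -- `x/2`; Fubini and Markov's inequality bound the probability of the latter.
  let J : ℝ → Ω → ℝ := fun r ω => max (S r ω - x / 2) 0
  have hJ : Measurable (Function.uncurry J) := (hS.sub_const _).max measurable_const
  have hJ0 : ∀ r ω, 0 ≤ J r ω := fun r ω => le_max_right _ _
  have hJ1 : ∀ r ω, |J r ω| ≤ C := fun r ω => by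
    rw [abs_of_nonneg (hJ0 r ω)]
    refine max_le ?_ ((abs_nonneg _).trans (hC r ω))
    linarith [(le_abs_self _).trans (hC r ω)]
  have hSr : ∀ ω, Measurable fun r => S r ω := fun ω =>
    hS.comp (measurable_id.prodMk measurable_const)
  have hJr : ∀ ω, Measurable fun r => J r ω := fun ω =>
    hJ.comp (measurable_id.prodMk measurable_const)
  have hJi : ∀ ω, IntervalIntegrable (fun r => J r ω) volume 0 h := fun ω =>
    intervalIntegrable_of_forall_abs_le (hJr ω) (fun r => hJ1 r ω) _ _
  have hfub : ∫ ω, (∫ r in (0 : ℝ)..h, J r ω) ∂P ≤ h * ε := by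
    have hint : Integrable (Function.uncurry J) ((volume.restrict (Set.uIoc 0 h)).prod P) := by
      rw [Set.uIoc]
      exact integrable_of_forall_abs_le hJ fun z => hJ1 z.1 z.2
    rw [← intervalIntegral_integral_swap hint]
    calc ∫ r in (0 : ℝ)..h, ∫ ω, J r ω ∂P ≤ ∫ r in (0 : ℝ)..h, ε := by
          refine intervalIntegral.integral_mono_on hh.le ?_ intervalIntegrable_const
            fun r _ => H r
          refine intervalIntegrable_of_forall_abs_le (C := C)
            hJ.stronglyMeasurable.integral_prod_right'.measurable (fun r => ?_) _ _
          exact abs_integral_le_of_forall_abs_le fun ω => hJ1 r ω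
      _ = h * ε := by simp
  have hIm : Measurable fun ω => ∫ r in (0 : ℝ)..h, J r ω := by
    simp only [intervalIntegral.integral_of_le hh.le]
    exact hJ.stronglyMeasurable.integral_prod_left'.measurable
  have hI0 : ∀ ω, 0 ≤ ∫ r in (0 : ℝ)..h, J r ω := fun ω =>
    intervalIntegral.integral_nonneg hh.le fun r _ => hJ0 r ω
  have hIi : Integrable (fun ω => ∫ r in (0 : ℝ)..h, J r ω) P := by
    refine integrable_of_forall_abs_le (C := h * C) hIm fun ω => ?_
    rw [abs_of_nonneg (hI0 ω)]
    calc ∫ r in (0 : ℝ)..h, J r ω ≤ ∫ r in (0 : ℝ)..h, C :=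
          intervalIntegral.integral_mono_on hh.le (hJi ω) intervalIntegrable_const
            fun r _ => (le_abs_self _).trans (hJ1 r ω)
      _ = h * C := by simp
  have hmark := mul_meas_ge_le_integral_of_nonneg (ae_of_all P hI0) hIi (x * h / 2)
  have hpoint : {ω | x * h ≤ ∫ r in (0 : ℝ)..h, S r ω}
      ⊆ {ω | x * h / 2 ≤ ∫ r in (0 : ℝ)..h, J r ω} := fun ω hω => by
    simp only [Set.mem_ofPred_eq] at hω ⊢
    have h1 : ∫ r in (0 : ℝ)..h, S r ω ≤ ∫ r in (0 : ℝ)..h, (x / 2 + J r ω) := by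
      refine intervalIntegral.integral_mono_on hh.le
        (intervalIntegrable_of_forall_abs_le (hSr ω) (fun r => hC r ω) _ _)
        (intervalIntegrable_const.add (hJi ω)) fun r _ => ?_
      linarith [le_max_left (S r ω - x / 2) 0]
    rw [intervalIntegral.integral_add intervalIntegrable_const (hJi ω),
      intervalIntegral.integral_const, sub_zero, smul_eq_mul] at h1
    linarith
  have hfin : x * h / 2 * P.real {ω | x * h ≤ ∫ r in (0 : ℝ)..h, S r ω} ≤ h * ε :=
    (mul_le_mul_of_nonneg_left (measureReal_mono hpoint) (by positivity)).trans
      (hmark.trans hfub)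
  have hxh : 0 < x * h / 2 := by positivity
  have e : 2 / x * ε = h * ε / (x * h / 2) := by field_simp
  rw [e, le_div_iff₀ hxh, mul_comm]
  exact hfin

theorem measurable_riemann (M : MarkovProcess E Ω) {f : E → ℝ} (hf : Measurable f) (h : ℝ≥0)
    (n : ℕ) (r : ℝ≥0) :
    Measurable fun ω => (h : ℝ) * ∑ i ∈ Finset.range n, f (M.X (r + i * h) ω) :=
  (Finset.measurable_sum _ fun _ _ => hf.comp (M.measurable_X_apply _)).const_mul _

theorem abs_riemann_le (M : MarkovProcess E Ω) {f : E → ℝ} {K : ℝ} (hK : ∀ x, |f x| ≤ K) (h : ℝ≥0)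
    (n : ℕ) (r : ℝ≥0) (ω : Ω) :
    |(h : ℝ) * ∑ i ∈ Finset.range n, f (M.X (r + i * h) ω)| ≤ K * (n * h) := by
  rw [← Fin.sum_univ_eq_sum_range fun i : ℕ => f (M.X (r + i * h) ω)]
  exact abs_mul_sum_le hK h n fun i : Fin n => M.X (r + i * h) ω

/-- A bound for the mean excess of Riemann sums, uniform in the starting point, gives a tail bound
for the integral. -/
theorem measureReal_integral_path_le (M : MarkovProcess E Ω) {μ : Measure E}
    [IsProbabilityMeasure μ] {f : E → ℝ} (hf : Measurable f) {K : ℝ}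
    (hK : ∀ x, |f x| ≤ K) {h : ℝ≥0} (hh : 0 < h) {n : ℕ} {x ε : ℝ} (hx : 0 < x)
    (H : ∀ r : ℝ≥0, ∫ ω, max ((h : ℝ) * ∑ i ∈ Finset.range n, f (M.X (r + i * h) ω) - x / 2) 0
      ∂(M.law μ) ≤ ε) :
    (M.law μ).real {ω | x ≤ ∫ s in (0 : ℝ)..(n * h), f (M.X s.toNNReal ω)} ≤ 2 / x * ε := by
  have hh' : (0 : ℝ) < h := hh
  let S : ℝ → Ω → ℝ := fun r ω => (h : ℝ) * ∑ i ∈ Finset.range n, f (M.X (r.toNNReal + i * h) ω)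
  have hS : Measurable (Function.uncurry S) :=
    (Finset.measurable_sum _ fun i _ => hf.comp (M.measurable_X.comp
      (((measurable_real_toNNReal.comp measurable_fst).add_const _).prodMk
        measurable_snd))).const_mul _
  have key := measureReal_le_integral_le (P := M.law μ) hS
    (fun r ω => M.abs_riemann_le hK h n r.toNNReal ω) hh' hx fun r => H r.toNNReal
  have e : ∀ ω, ∫ r in (0 : ℝ)..h, S r ω = h * ∫ s in (0 : ℝ)..(n * h), f (M.X s.toNNReal ω) :=
    fun ω => by
      rw [M.integral_path_eq hf hK h n ω, ← intervalIntegral.integral_const_mul]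
  refine (measureReal_mono fun ω hω => ?_).trans key
  simp only [Set.mem_ofPred_eq] at hω ⊢
  rw [e, mul_comm]
  exact mul_le_mul_of_nonneg_left hω hh'.le

/-- The mean excess over `x`, from the tail probabilities at the levels `x + jd`. -/
theorem _root_.MeasureTheory.integral_max_sub_le {Ω : Type*} [MeasurableSpace Ω]
    {P : Measure Ω} [IsProbabilityMeasure P] {S : Ω → ℝ} (hS : Measurable S) {x d : ℝ} (hd : 0 < d)
    {n : ℕ} (hn : ∀ ω, S ω ≤ x + n * d) {p : ℕ → ℝ} (hp : ∀ j : ℕ, P.real {ω | x + j * d ≤ S ω} ≤ p j) :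
    ∫ ω, max (S ω - x) 0 ∂P ≤ d * ∑ j ∈ Finset.range n, p j := by
  have hm : ∀ j : ℕ, MeasurableSet {ω | x + j * d ≤ S ω} := fun j =>
    measurableSet_le measurable_const hS
  have hi : ∀ j : ℕ, Integrable ({ω | x + j * d ≤ S ω}.indicator (1 : Ω → ℝ)) P := fun j =>
    (integrable_const (1 : ℝ)).indicator (hm j)
  have hpt : ∀ ω, max (S ω - x) 0
      ≤ d * ∑ j ∈ Finset.range n, {ω | x + j * d ≤ S ω}.indicator (1 : Ω → ℝ) ω := by
    intro ω
    have hnn : ∀ j, 0 ≤ {ω | x + (j : ℕ) * d ≤ S ω}.indicator (1 : Ω → ℝ) ω := fun j =>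
      Set.indicator_nonneg (by simp) _
    refine max_le ?_ (mul_nonneg hd.le (Finset.sum_nonneg fun j _ => hnn j))
    have hind : ∀ k : ℕ, (S ω ≤ x + k * d) →
        S ω - x ≤ d * ∑ j ∈ Finset.range k, {ω | x + j * d ≤ S ω}.indicator (1 : Ω → ℝ) ω := by
      intro k
      induction k with
      | zero => intro hk; simp at hk ⊢; exact hk
      | succ k ih =>
        intro hk
        rw [Finset.sum_range_succ, mul_add]
        by_cases hkk : x + k * d ≤ S ω
        · have h1 : ∀ j ∈ Finset.range k,
              {ω | x + j * d ≤ S ω}.indicator (1 : Ω → ℝ) ω = 1 := fun j hj => by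
            refine Set.indicator_of_mem ?_ _
            have hjk : (j : ℝ) ≤ k := by exact_mod_cast (Finset.mem_range.mp hj).le
            have := mul_le_mul_of_nonneg_right hjk hd.le
            simp only [Set.mem_ofPred_eq]
            linarith
          rw [Finset.sum_congr rfl h1, Set.indicator_of_mem (by exact hkk)]
          push_cast at hk
          simp
          linarith
        · have := ih (not_le.mp hkk).le
          have := mul_nonneg hd.le (hnn k)
          linarith
    exact hind n (hn ω)
  have hsum : Integrable (fun ω => d * ∑ j ∈ Finset.range n,
      {ω | x + j * d ≤ S ω}.indicator (1 : Ω → ℝ) ω) P :=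
    (integrable_finsetSum _ fun j _ => hi j).const_mul d
  calc ∫ ω, max (S ω - x) 0 ∂P
      ≤ ∫ ω, d * ∑ j ∈ Finset.range n, {ω | x + j * d ≤ S ω}.indicator (1 : Ω → ℝ) ω ∂P :=
        integral_mono_of_nonneg (ae_of_all _ fun ω => le_max_right _ _) hsum (ae_of_all _ hpt)
    _ = d * ∑ j ∈ Finset.range n, P.real {ω | x + j * d ≤ S ω} := by
        rw [integral_const_mul, integral_finsetSum _ fun j _ => hi j]
        simp_rw [fun j => integral_indicator_one (μ := P) (hm j)]
    _ ≤ _ := by gcongr; exact hp _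

/-! ### Tail bounds for the time integral, by counting and by exponential moments. -/

theorem _root_.exists_mesh {ℓ a : ℝ} (hℓ : 0 < ℓ) (ha : 0 < a) :
    ∃ (h : ℝ≥0) (q : ℕ), 0 < h ∧ (h : ℝ) ≤ a ∧ (q : ℝ) * h = ℓ := by
  obtain ⟨n, hn⟩ := exists_nat_gt (ℓ / a)
  have hn0 : (0 : ℝ) < n := (div_pos hℓ ha).trans hn
  have hd : 0 < ℓ / n := div_pos hℓ hn0
  refine ⟨(ℓ / n).toNNReal, n, Real.toNNReal_pos.mpr hd, ?_, ?_⟩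
  · rw [Real.coe_toNNReal _ hd.le, div_le_iff₀ hn0]
    rw [div_lt_iff₀ ha] at hn
    linarith
  · rw [Real.coe_toNNReal _ hd.le]
    field_simp

/-- Tail bound by counting the blocks of length `ℓ` whose average is large. -/
theorem measureReal_integral_le_of_count (M : MarkovProcess E Ω) {μ : Measure E}
    [IsProbabilityMeasure μ] (hμ : M.IsInvariant μ) {α : ℝ≥0 → ℝ} (hα : M.IsMixing μ α)
    (hα0 : ∀ s, 0 ≤ α s) {c a : ℝ} (hc : 0 ≤ c) (ha : 0 < a)
    (hαa : ∀ s : ℝ≥0, α s ≤ c * (4 * a ^ 2 / (a + s) ^ 2)) {f : E → ℝ} (hf : Measurable f)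
    (hK : ∀ x, |f x| ≤ 2) (hf0 : ∫ x, f x ∂μ = 0) {R t b : ℝ} (hR : 0 < R) (hb : 0 < b)
    {N : ℕ} (hN : 1 ≤ N) {ℓ : ℝ≥0} (hℓ : 0 < ℓ) (hℓt : 2 * N * (ℓ : ℝ) = t) :
    (M.law μ).real {ω | R * t ≤ ∫ s in (0 : ℝ)..t, f (M.X s.toNNReal ω)}
      ≤ 8 / R * ((1 + Real.exp b * (2048 * c * a / (R ^ 2 * ℓ))) ^ N
        * (Real.exp (-(b * ⌈R * N / 8⌉₊)) + 2 * N * α ℓ)) := by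
  have hℓ' : (0 : ℝ) < ℓ := hℓ
  have hN' : (0 : ℝ) < N := by exact_mod_cast hN
  have ht : 0 < t := by rw [← hℓt]; positivity
  obtain ⟨h, q, hh, hha, hq⟩ := exists_mesh hℓ' ha
  have hq' : (q : ℝ≥0) * h = ℓ := NNReal.eq (by push_cast; exact hq)
  have hn : ((2 * N * q : ℕ) : ℝ) * h = t := by push_cast; rw [← hℓt, ← hq]; ring
  set k := ⌈R * N / 8⌉₊ with hk
  have hk1 : 1 ≤ k := Nat.one_le_iff_ne_zero.mpr (Nat.ceil_pos.mpr (by positivity)).ne'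
  have hkup : (k : ℝ) < R * N / 8 + 1 := Nat.ceil_lt_add_one (by positivity)
  set κ := R * ℓ / 4 with hκ
  have hκ0 : 0 < κ := by positivity
  -- The level `Rt` is halved twice: once for the excess of Riemann sums, once for the two parities.
  -- If fewer than `RN/8` blocks exceed `κ = Rℓ/4`, the sum is below `Nκ + (RN/8)·2ℓ = Rt/4`.
  have hpar : ∀ r : ℝ≥0, (M.law μ).real
      {ω | R * t / 2 / 2 ≤ ∑ j ∈ Finset.range N, M.block f h q (r + j * (2 * (q * h))) ω}
      ≤ (1 + Real.exp b * (2048 * c * a / (R ^ 2 * ℓ))) ^ N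
        * (Real.exp (-(b * k)) + 2 * N * α ℓ) := by
    intro r
    have hv := M.integral_sq_block_le hμ hα hα0 hc ha hαa r h hha q hf hK hf0
    have key := M.measureReal_card_block_le hμ hα hα0 r h q hf hK hv hκ0 hb hk1 N
    rw [hq'] at key ⊢
    have e : 32 * c * 2 ^ 2 * a * (q * h) / κ ^ 2 = 2048 * c * a / (R ^ 2 * ℓ) := by
      rw [hq, hκ]; field_simp; ring
    rw [e] at key
    refine (measureReal_mono fun ω hω => ?_).trans key
    simp only [Set.mem_ofPred_eq] at hω ⊢
    by_contra hlt
    rw [not_le] at hlt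
    set A := (Finset.range N).filter fun j : ℕ => κ < M.block f h q (r + j * (2 * ℓ)) ω with hA
    have h1 : ∀ j ∈ Finset.range N, M.block f h q (r + j * (2 * ℓ)) ω
        ≤ κ + if κ < M.block f h q (r + j * (2 * ℓ)) ω then 2 * (ℓ : ℝ) else 0 := fun j _ => by
      split_ifs with hj
      · have := (le_abs_self _).trans (M.abs_block_le hK h q (r + j * (2 * ℓ)) ω)
        rw [hq] at this
        linarith
      · linarith
    have h2 := Finset.sum_le_sum h1
    rw [Finset.sum_add_distrib, ← Finset.sum_filter, Finset.sum_const, Finset.sum_const,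
      Finset.card_range, nsmul_eq_mul, nsmul_eq_mul, ← hA] at h2
    have h3 : (A.card : ℝ) + 1 ≤ k := by exact_mod_cast hlt
    have h4 : (A.card : ℝ) < R * N / 8 := by linarith
    have h5 : (A.card : ℝ) * (2 * ℓ) < R * N / 8 * (2 * ℓ) := by gcongr
    rw [← hℓt, hκ] at *
    nlinarith
  set β := (1 + Real.exp b * (2048 * c * a / (R ^ 2 * ℓ))) ^ N
    * (Real.exp (-(b * k)) + 2 * N * α ℓ) with hβ
  have hriem := M.measureReal_riemann_le_of_parity hpar
  have hexc : ∀ r : ℝ≥0, ∫ ω, max ((h : ℝ) * ∑ i ∈ Finset.range (2 * N * q),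
      f (M.X (r + i * h) ω) - R * t / 2) 0 ∂(M.law μ) ≤ 4 * t * β := fun r => by
    -- Since `|f| ≤ 2`, the Riemann sum is at most `2t`, so a single level of width `2t` suffices.
    have h1 := integral_max_sub_le (P := M.law μ) (M.measurable_riemann hf h (2 * N * q) r)
      (x := R * t / 2) (d := 2 * t) (by positivity) (n := 1 + 0)
      (fun ω => by
        have h2 := (le_abs_self _).trans (M.abs_riemann_le hK h (2 * N * q) r ω)
        rw [hn] at h2
        have h3 : 0 < R * t := by positivity
        push_cast
        linarith)
      (p := fun _ => 2 * β)
      (fun j => (measureReal_mono fun ω hω => by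
        have h3 : 0 ≤ (j : ℝ) * (2 * t) := by positivity
        simp only [Set.mem_ofPred_eq] at hω ⊢
        linarith).trans (hriem r))
    simp only [add_zero, Finset.sum_range_one] at h1
    linarith
  have key := M.measureReal_integral_path_le hf hK hh (by positivity) hexc
  rw [hn] at key
  refine key.trans (le_of_eq ?_)
  field_simp
  ring

/-- Tail bound by an exponential moment of the averages over blocks of length `ℓ`. -/
theorem measureReal_integral_le_of_exp (M : MarkovProcess E Ω) {μ : Measure E}
    [IsProbabilityMeasure μ] (hμ : M.IsInvariant μ) {α : ℝ≥0 → ℝ} (hα : M.IsMixing μ α)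
    (hα0 : ∀ s, 0 ≤ α s) {c a : ℝ} (hc : 0 ≤ c) (ha : 0 < a)
    (hαa : ∀ s : ℝ≥0, α s ≤ c * (4 * a ^ 2 / (a + s) ^ 2)) {f : E → ℝ} (hf : Measurable f)
    (hK : ∀ x, |f x| ≤ 2) (hf0 : ∫ x, f x ∂μ = 0) {R t : ℝ} (hR : 0 < R)
    {N : ℕ} (hN : 1 ≤ N) {ℓ : ℝ≥0} (hℓ : 0 < ℓ) (hℓt : 2 * N * (ℓ : ℝ) = t) :
    (M.law μ).real {ω | R * t ≤ ∫ s in (0 : ℝ)..t, f (M.X s.toNNReal ω)}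
      ≤ 16 / (R * N) * ((1 + 32 * c * a / ℓ) ^ N
        * (2 * Real.exp (-(R * N / 8)) + 6 * N ^ 2 * α ℓ)) := by
  have hℓ' : (0 : ℝ) < ℓ := hℓ
  have hN' : (0 : ℝ) < N := by exact_mod_cast hN
  have ht : 0 < t := by rw [← hℓt]; positivity
  obtain ⟨h, q, hh, hha, hq⟩ := exists_mesh hℓ' ha
  have hq' : (q : ℝ≥0) * h = ℓ := NNReal.eq (by push_cast; exact hq)
  have hn : ((2 * N * q : ℕ) : ℝ) * h = t := by push_cast; rw [← hℓt, ← hq]; ring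
  set G := (1 + 32 * c * a / ℓ) ^ N with hG
  have hG0 : 0 ≤ G := by positivity
  have hpar : ∀ y : ℝ, 0 < y → ∀ r : ℝ≥0, (M.law μ).real
      {ω | y / 2 ≤ ∑ j ∈ Finset.range N, M.block f h q (r + j * (2 * (q * h))) ω}
      ≤ G * (Real.exp (-(y / (8 * ℓ))) + 6 * N * α ℓ) := by
    intro y hy r
    have hv := M.integral_sq_block_le hμ hα hα0 hc ha hαa r h hha q hf hK hf0
    -- A block is at most `2ℓ` in absolute value, so `a = 1/(2ℓ)` is the largest multiplier
    -- guaranteed to keep the exponent in `[-1,1]`.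
    have key := M.measureReal_lt_sum_block_le hμ hα hα0 r h q hf hK hf0 hv (a := 1 / (2 * ℓ))
      (x := y / (8 * ℓ)) (by positivity) (by rw [hq]; field_simp; norm_num) (by positivity) N
    rw [hq'] at key ⊢
    have e : (1 / (2 * (ℓ : ℝ))) ^ 2 * (32 * c * 2 ^ 2 * a * (q * h)) = 32 * c * a / ℓ := by
      rw [hq]; field_simp
    rw [e] at key
    refine (measureReal_mono fun ω hω => ?_).trans key
    simp only [Set.mem_ofPred_eq] at hω ⊢
    have h1 : 1 / (2 * (ℓ : ℝ)) * (y / 2) = y / (8 * ℓ) + y / (8 * ℓ) := by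
      field_simp; norm_num
    have h2 := mul_le_mul_of_nonneg_left hω (show 0 ≤ 1 / (2 * (ℓ : ℝ)) by positivity)
    rw [h1] at h2
    have h3 : 0 < y / (8 * ℓ) := by positivity
    linarith
  have hexc : ∀ r : ℝ≥0, ∫ ω, max ((h : ℝ) * ∑ i ∈ Finset.range (2 * N * q),
      f (M.X (r + i * h) ω) - R * t / 2) 0 ∂(M.law μ)
        ≤ 8 * ℓ * (2 * (G * (2 * Real.exp (-(R * N / 8)) + 6 * N ^ 2 * α ℓ))) := fun r => by
    -- Raising the level by `8ℓ` gains a factor `e^{-1}`, so the tails sum geometrically; `N` levels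
    -- span `8ℓN = 4t`, beyond the maximum `2t`.
    have h1 := integral_max_sub_le (P := M.law μ) (M.measurable_riemann hf h (2 * N * q) r)
      (x := R * t / 2) (d := 8 * ℓ) (by positivity) (n := N)
      (fun ω => by
        have h2 := (le_abs_self _).trans (M.abs_riemann_le hK h (2 * N * q) r ω)
        rw [hn] at h2
        have h3 : 0 < R * t := by positivity
        nlinarith)
      (p := fun j => 2 * (G * (Real.exp (-(R * N / 8)) * Real.exp (-1) ^ j + 6 * N * α ℓ)))
      (fun j => by
        have h2 := M.measureReal_riemann_le_of_parity (hpar (R * t / 2 + j * (8 * ℓ))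
          (by positivity)) r
        have h3 : (R * t / 2 + j * (8 * ℓ)) / (8 * ℓ) = R * N / 8 + j := by
          rw [← hℓt]; field_simp
        rw [h3, neg_add, Real.exp_add] at h2
        rw [← Real.exp_nat_mul, mul_neg_one]
        exact h2)
    refine h1.trans ?_
    rw [← Finset.mul_sum, ← Finset.mul_sum, Finset.sum_add_distrib, ← Finset.mul_sum]
    have hgeo : ∑ j ∈ Finset.range N, Real.exp (-1) ^ j ≤ 2 := by
      have he : Real.exp (-1) ≤ 1 / 2 := by
        rw [Real.exp_neg, inv_eq_one_div]
        have := Real.add_one_le_exp (1 : ℝ)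
        exact one_div_le_one_div_of_le two_pos (by linarith)
      calc ∑ j ∈ Finset.range N, Real.exp (-1) ^ j ≤ ∑ j ∈ Finset.range N, (1 / 2 : ℝ) ^ j := by
            gcongr
        _ ≤ 2 := sum_geometric_two_le N
    have e : ∑ j ∈ Finset.range N, 6 * (N : ℝ) * α ℓ = 6 * N ^ 2 * α ℓ := by simp; ring
    rw [e, mul_comm 2 (Real.exp _)]
    gcongr
  have key := M.measureReal_integral_path_le hf hK hh (by positivity) hexc
  rw [hn] at key
  refine key.trans (le_of_eq ?_)
  rw [← hℓt]
  field_simp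
  ring

end MarkovProcess

/-! ### Numerical estimates with constants uniform in `θ`. -/

/-- With `z = (s/τ)^{1/θ}`, raising `z/2 ≤ e^{z/2}` to the power `θ` gives `s/a ≤ e^{θz/2}` for `a =
2^θ τ`. Hence the stretched exponential decays quadratically beyond the correlation length `a`, with
no other dependence on `θ`. -/
theorem exp_neg_mul_rpow_le {θ τ s : ℝ} (hθ : 1 ≤ θ) (hτ : 0 < τ) (hs : 0 ≤ s) :
    Real.exp (-(θ * (s / τ) ^ (1 / θ)))
      ≤ 4 * ((2 : ℝ) ^ θ * τ) ^ 2 / ((2 : ℝ) ^ θ * τ + s) ^ 2 := by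
  have hθ0 : 0 < θ := by linarith
  set a := (2 : ℝ) ^ θ * τ with ha
  have ha0 : 0 < a := by positivity
  set z := (s / τ) ^ (1 / θ) with hz
  have hz0 : 0 ≤ z := by positivity
  rcases le_total s a with h | h
  · have h1 : Real.exp (-(θ * z)) ≤ 1 := Real.exp_le_one_iff.mpr (by nlinarith)
    refine h1.trans ?_
    rw [one_le_div (by positivity)]
    nlinarith
  · have hs0 : 0 < s := ha0.trans_le h
    have hzθ : z ^ θ = s / τ := by
      rw [hz, ← Real.rpow_mul (by positivity), one_div_mul_cancel hθ0.ne', Real.rpow_one]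
    have h1 : s / a ≤ Real.exp (θ * z / 2) := by
      have h2 : z / 2 ≤ Real.exp (z / 2) := by linarith [Real.add_one_le_exp (z / 2)]
      have h3 := Real.rpow_le_rpow (by positivity) h2 hθ0.le
      rw [Real.div_rpow hz0 zero_le_two, hzθ, ← Real.exp_mul] at h3
      calc s / a = s / τ / 2 ^ θ := by rw [ha]; field_simp
        _ ≤ _ := h3
        _ = _ := by congr 1; ring
    have h4 : Real.exp (-(θ * z)) ≤ (a / s) ^ 2 := by
      have h5 : Real.exp (-(θ * z)) = ((Real.exp (θ * z / 2)) ^ 2)⁻¹ := by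
        rw [← Real.exp_nat_mul, ← Real.exp_neg]; congr 1; push_cast; ring
      rw [h5, ← inv_div s a, inv_pow]
      gcongr
    refine h4.trans ?_
    rw [div_pow, div_le_div_iff₀ (by positivity) (by positivity)]
    have h6 : (a + s) ^ 2 ≤ 4 * s ^ 2 := by nlinarith
    nlinarith [sq_nonneg a]

/-- Since `(2/R)^{1/θ} ≥ 1 + log(2/R)/θ`, the exponent exceeds `θm` by `m·log(2/R)`. The resulting
factor `(R/2)^m` pays for the powers of `1/R` in the counting bound. -/
theorem exp_neg_mul_rpow_le_of_two_mul {θ τ m R ℓ : ℝ} (hθ : 1 ≤ θ) (hτ : 0 < τ) (hm : 0 < m)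
    (hR : 0 < R) (hℓ : 2 * m ^ θ * τ / R ≤ ℓ) :
    Real.exp (-(θ * (ℓ / τ) ^ (1 / θ))) ≤ Real.exp (-(θ * m)) * (R / 2) ^ m := by
  have hθ0 : 0 < θ := by linarith
  have h1 : m * (2 / R) ^ (1 / θ) ≤ (ℓ / τ) ^ (1 / θ) := by
    have h2 : m = (m ^ θ) ^ (1 / θ) := by
      rw [← Real.rpow_mul hm.le, mul_one_div_cancel hθ0.ne', Real.rpow_one]
    nth_rewrite 1 [h2]
    rw [← Real.mul_rpow (by positivity) (by positivity)]
    refine Real.rpow_le_rpow (by positivity) ?_ (by positivity)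
    rw [le_div_iff₀ hτ]
    refine le_trans (le_of_eq ?_) hℓ
    field_simp
  have h3 : 1 + 1 / θ * Real.log (2 / R) ≤ (2 / R) ^ (1 / θ) := by
    rw [Real.rpow_def_of_pos (by positivity)]
    linarith [Real.add_one_le_exp (Real.log (2 / R) * (1 / θ))]
  have h4 : θ * m + m * Real.log (2 / R) ≤ θ * (ℓ / τ) ^ (1 / θ) := by
    have h5 : θ * (m * (1 + 1 / θ * Real.log (2 / R))) ≤ θ * (ℓ / τ) ^ (1 / θ) := by
      gcongr
      exact (mul_le_mul_of_nonneg_left h3 hm.le).trans h1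
    refine le_trans (le_of_eq ?_) h5
    field_simp
  have h6 : (R / 2) ^ m = Real.exp (-(m * Real.log (2 / R))) := by
    rw [Real.rpow_def_of_pos (by positivity), ← inv_div 2 R, Real.log_inv]
    congr 1; ring
  rw [h6, ← Real.exp_add]
  refine Real.exp_le_exp.mpr (by linarith)

/-- The loss `(9θ)^{1/θ}` caused by shorter blocks is at most `25` for all `θ ≥ 1`, by Bernoulli's
inequality. -/
theorem exp_neg_mul_rpow_le_of_div {θ τ m R ρ ℓ : ℝ} (hθ : 1 ≤ θ) (hτ : 0 < τ) (hm : 0 < m)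
    (hR : 0 < R) (hρ : 0 < ρ) (hρR : ρ ^ θ = 1 / R) (hℓ : m ^ θ * τ / (9 * R * θ) ≤ ℓ) :
    Real.exp (-(θ * (ℓ / τ) ^ (1 / θ))) ≤ Real.exp (-(θ * m * ρ / 25)) := by
  have hθ0 : 0 < θ := by linarith
  have h1 : m * ρ / 25 ≤ (ℓ / τ) ^ (1 / θ) := by
    have h2 : m * ρ / 25 = ((m * ρ / 25) ^ θ) ^ (1 / θ) := by
      rw [← Real.rpow_mul (by positivity), mul_one_div_cancel hθ0.ne', Real.rpow_one]
    rw [h2]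
    refine Real.rpow_le_rpow (by positivity) ?_ (by positivity)
    rw [le_div_iff₀ hτ, Real.div_rpow (by positivity) (by norm_num),
      Real.mul_rpow hm.le hρ.le, hρR]
    refine le_trans ?_ hℓ
    have h9 : 9 * θ ≤ (25 : ℝ) ^ θ := by
      have h10 := one_add_mul_self_le_rpow_one_add (show (-1 : ℝ) ≤ 24 by norm_num) hθ
      norm_num at h10
      linarith
    rw [mul_one_div, div_div, div_mul_eq_mul_div, div_le_div_iff₀ (by positivity) (by positivity)]
    have h11 := mul_le_mul_of_nonneg_left h9 (show 0 ≤ m ^ θ * τ * R by positivity)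
    linarith
  refine Real.exp_le_exp.mpr ?_
  have := mul_le_mul_of_nonneg_left h1 hθ0.le
  linarith

theorem mul_rpow_div_le {Q m θ : ℝ} (hQ : 0 < Q) (hQm : Q ≤ m) (hθ : 1 ≤ θ) :
    m * (Q / m) ^ θ ≤ Q := by
  have hm : 0 < m := hQ.trans_le hQm
  have h1 : (Q / m) ^ θ ≤ (Q / m) ^ (1 : ℝ) :=
    Real.rpow_le_rpow_of_exponent_ge (by positivity) ((div_le_one hm).mpr hQm) hθ
  rw [Real.rpow_one] at h1
  calc m * (Q / m) ^ θ ≤ m * (Q / m) := by gcongr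
    _ = Q := by field_simp

theorem one_add_pow_le_exp_mul {x : ℝ} (hx : 0 ≤ x) (N : ℕ) : (1 + x) ^ N ≤ Real.exp (N * x) := by
  rw [Real.exp_nat_mul]
  gcongr
  linarith [Real.add_one_le_exp x]

/-- Numerical part of the counting bound: `N` is the number of pairs of blocks of length `ℓ`. -/
theorem count_bound_le {c θ τ m R t ℓ : ℝ} {N : ℕ} (hc : 0 < c) (hθ : 1 ≤ θ) (hτ : 0 < τ)
    (hR : 0 < R) (hR1 : R ≤ 1) (hRt : R ^ 2 * t = 4 * m ^ (1 + θ) * τ)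
    (hRθ : 1 / R ≤ (100 : ℝ) ^ θ) {C : ℝ} (hC : C = 20480000 * c * Real.exp 32)
    (hm1 : 8 + C ≤ m) (hm2 : 20000 * Real.exp 32 ≤ m) (hm3 : 288 * c * Real.exp C ≤ m)
    (hN1 : m / (2 * R) ≤ N) (hN2 : N ≤ m / R) (hℓt : 2 * N * ℓ = t) :
    8 / R * ((1 + Real.exp (32 * θ) * (2048 * c * ((2 : ℝ) ^ θ * τ) / (R ^ 2 * ℓ))) ^ N
        * (Real.exp (-(32 * θ * ⌈R * N / 8⌉₊)) + 2 * N * (c * Real.exp (-(θ * (ℓ / τ) ^ (1 / θ))))))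
      ≤ Real.exp (-(θ * m)) := by
  have hC0 : 0 < C := by rw [hC]; positivity
  have hm8 : 8 ≤ m := by linarith
  have hm0 : 0 < m := by linarith
  have hθ0 : 0 < θ := by linarith
  have hN0 : (0 : ℝ) < N := lt_of_lt_of_le (by positivity) hN1
  have ht : 0 < t := by
    have : 0 < R ^ 2 * t := by rw [hRt]; positivity
    exact (mul_pos_iff_of_pos_left (by positivity)).mp this
  have hℓ : ℓ = t / (2 * N) := by rw [← hℓt]; field_simp
  have hℓ0 : 0 < ℓ := by rw [hℓ]; positivity
  have hmθ : m ^ (1 + θ) = m * m ^ θ := by rw [Real.rpow_add hm0, Real.rpow_one]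
  have hG : (1 + Real.exp (32 * θ) * (2048 * c * ((2 : ℝ) ^ θ * τ) / (R ^ 2 * ℓ))) ^ N
      ≤ Real.exp C := by
    refine (one_add_pow_le_exp_mul (by positivity) N).trans (Real.exp_le_exp.mpr ?_)
    have e1 : N * (Real.exp (32 * θ) * (2048 * c * ((2 : ℝ) ^ θ * τ) / (R ^ 2 * ℓ)))
        = N ^ 2 * (1024 * c * (2 ^ θ * Real.exp (32 * θ)) / (m * m ^ θ)) := by
      rw [hℓ, show R ^ 2 * (t / (2 * N)) = R ^ 2 * t / (2 * N) by ring, hRt, hmθ]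
      field_simp
      ring
    have e2 : (1 / R) ^ 2 ≤ ((100 : ℝ) ^ θ) ^ 2 := by gcongr
    have e3 : (N : ℝ) ^ 2 ≤ m ^ 2 * ((100 : ℝ) ^ θ) ^ 2 := by
      calc (N : ℝ) ^ 2 ≤ (m / R) ^ 2 := by gcongr
        _ = m ^ 2 * (1 / R) ^ 2 := by ring
        _ ≤ _ := by gcongr
    -- All factors growing with `θ` form one `θ`-th power of a constant `Q ≤ m`. Then
    -- `mul_rpow_div_le` bounds `m(Q/m)^θ` by `Q`, independently of `θ`.
    have e4 : ((100 : ℝ) ^ θ) ^ 2 * (2 ^ θ * Real.exp (32 * θ)) = (20000 * Real.exp 32) ^ θ := by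
      rw [Real.mul_rpow (by norm_num) (Real.exp_pos _).le, ← Real.exp_mul, ← mul_assoc]
      congr 1
      rw [← Real.rpow_natCast, ← Real.rpow_mul (by norm_num), mul_comm θ, Real.rpow_mul (by norm_num),
        ← Real.mul_rpow (by positivity) (by norm_num)]
      norm_num
    calc N * (Real.exp (32 * θ) * (2048 * c * ((2 : ℝ) ^ θ * τ) / (R ^ 2 * ℓ)))
        = N ^ 2 * (1024 * c * (2 ^ θ * Real.exp (32 * θ)) / (m * m ^ θ)) := e1
      _ ≤ m ^ 2 * ((100 : ℝ) ^ θ) ^ 2 * (1024 * c * (2 ^ θ * Real.exp (32 * θ)) / (m * m ^ θ)) := by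
          gcongr
      _ = 1024 * c * (m * ((((100 : ℝ) ^ θ) ^ 2 * (2 ^ θ * Real.exp (32 * θ))) / m ^ θ)) := by
          field_simp
      _ = 1024 * c * (m * ((20000 * Real.exp 32) / m) ^ θ) := by
          rw [e4, Real.div_rpow (by positivity) hm0.le]
      _ ≤ 1024 * c * (20000 * Real.exp 32) :=
          mul_le_mul_of_nonneg_left (mul_rpow_div_le (by positivity) hm2 hθ) (by positivity)
      _ = C := by rw [hC]; ring
  -- `N ≥ m/(2R)` forces a count of at least `m/16`, so the weight `32θ` yields `exp(-2θm)`. Half of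
  -- this exponent absorbs `16/R ≤ e^{3+5θ}` and `e^C`, because `m ≥ 8 + C`.
  have h1 : 8 / R * Real.exp C * Real.exp (-(32 * θ * ⌈R * N / 8⌉₊)) ≤ Real.exp (-(θ * m)) / 2 := by
    have e1 : m / 16 ≤ (⌈R * N / 8⌉₊ : ℝ) := by
      refine le_trans ?_ (Nat.le_ceil _)
      rw [div_le_iff₀ (by positivity)] at hN1
      linarith
    have e2 : Real.exp (-(32 * θ * ⌈R * N / 8⌉₊)) ≤ Real.exp (-(2 * θ * m)) := by
      refine Real.exp_le_exp.mpr ?_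
      have := mul_le_mul_of_nonneg_left e1 (show 0 ≤ 32 * θ by positivity)
      linarith
    have e3 : (16 : ℝ) ≤ Real.exp 3 := by
      have : (2.7 : ℝ) ≤ Real.exp 1 := by linarith [Real.exp_one_gt_d9]
      have h3 : Real.exp 3 = Real.exp 1 ^ 3 := by rw [← Real.exp_nat_mul]; norm_num
      rw [h3]
      calc (16 : ℝ) ≤ 2.7 ^ 3 := by norm_num
        _ ≤ _ := by gcongr
    have e4 : (100 : ℝ) ^ θ ≤ Real.exp (5 * θ) := by
      have : (2.7 : ℝ) ≤ Real.exp 1 := by linarith [Real.exp_one_gt_d9]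
      have h3 : Real.exp 5 = Real.exp 1 ^ 5 := by rw [← Real.exp_nat_mul]; norm_num
      rw [Real.exp_mul]
      refine Real.rpow_le_rpow (by norm_num) ?_ hθ0.le
      rw [h3]
      calc (100 : ℝ) ≤ 2.7 ^ 5 := by norm_num
        _ ≤ _ := by gcongr
    calc 8 / R * Real.exp C * Real.exp (-(32 * θ * ⌈R * N / 8⌉₊))
        = 16 * (1 / R) * Real.exp C * Real.exp (-(32 * θ * ⌈R * N / 8⌉₊)) / 2 := by ring
      _ ≤ Real.exp 3 * Real.exp (5 * θ) * Real.exp C * Real.exp (-(2 * θ * m)) / 2 := by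
          gcongr
          exact hRθ.trans e4
      _ = Real.exp (3 + 5 * θ + C - 2 * θ * m) / 2 := by
          rw [← Real.exp_add, ← Real.exp_add, ← Real.exp_add]; ring_nf
      _ ≤ Real.exp (-(θ * m)) / 2 := by
          gcongr
          nlinarith
  have h2 : 8 / R * Real.exp C * (2 * N * (c * Real.exp (-(θ * (ℓ / τ) ^ (1 / θ)))))
      ≤ Real.exp (-(θ * m)) / 2 := by
    have e1 : 2 * m ^ θ * τ / R ≤ ℓ := by
      have e2 : 2 * m ^ θ * τ / R = R * t / (2 * m) := by
        rw [div_eq_div_iff hR.ne' (by positivity)]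
        calc 2 * m ^ θ * τ * (2 * m) = 4 * (m * m ^ θ) * τ := by ring
          _ = R ^ 2 * t := by rw [← hmθ, hRt]
          _ = _ := by ring
      rw [e2, hℓ, div_le_div_iff₀ (by positivity) (by positivity)]
      rw [le_div_iff₀ hR] at hN2
      nlinarith
    have e2 := exp_neg_mul_rpow_le_of_two_mul hθ hτ hm0 hR e1
    -- `R²` cancels the two factors `1/R`, from Markov's inequality and from `N ≤ m/R`; of `1/m²`,
    -- one factor cancels the `m` in `N` and the other absorbs the constants.
    have e3 : (R / 2) ^ m ≤ R ^ 2 * (9 / m ^ 2) := by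
      rw [Real.div_rpow hR.le zero_le_two, div_eq_mul_inv]
      have e4 : R ^ m ≤ R ^ 2 := by
        have := Real.rpow_le_rpow_of_exponent_ge hR hR1 (show (2 : ℝ) ≤ m by linarith)
        exact_mod_cast this
      have e5 : m ^ 2 / 9 ≤ 2 ^ m := by
        have h3 : m / 3 ≤ Real.exp (Real.log 2 * (m / 2)) := by
          have := Real.add_one_le_exp (Real.log 2 * (m / 2))
          have := Real.log_two_gt_d9
          nlinarith
        rw [Real.rpow_def_of_pos zero_lt_two]
        calc m ^ 2 / 9 = (m / 3) ^ 2 := by ring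
          _ ≤ (Real.exp (Real.log 2 * (m / 2))) ^ 2 := by gcongr
          _ = _ := by rw [← Real.exp_nat_mul]; congr 1; push_cast; ring
      have e6 : ((2 : ℝ) ^ m)⁻¹ ≤ 9 / m ^ 2 := by
        rw [← inv_div]
        gcongr
      gcongr
    calc 8 / R * Real.exp C * (2 * N * (c * Real.exp (-(θ * (ℓ / τ) ^ (1 / θ)))))
        ≤ 8 / R * Real.exp C * (2 * (m / R) * (c * (Real.exp (-(θ * m)) * (R ^ 2 * (9 / m ^ 2))))) := by
          gcongr
          exact e2.trans (by gcongr)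
      _ = 288 * c * Real.exp C / m * (Real.exp (-(θ * m)) / 2) := by
          field_simp; ring
      _ ≤ 1 * (Real.exp (-(θ * m)) / 2) := by
          gcongr
          exact (div_le_one hm0).mpr hm3
      _ = _ := one_mul _
  calc _ ≤ 8 / R * (Real.exp C * (Real.exp (-(32 * θ * ⌈R * N / 8⌉₊))
        + 2 * N * (c * Real.exp (-(θ * (ℓ / τ) ^ (1 / θ)))))) := by gcongr
    _ ≤ _ := by linarith

/-- Numerical part of the exponential moment bound. -/
theorem exp_bound_le {c θ τ m R t ℓ : ℝ} {N : ℕ} (hc : 0 < c) (hθ : 1 ≤ θ) (hτ : 0 < τ)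
    (hR : 0 < R) (hRt : R ^ 2 * t = 4 * m ^ (1 + θ) * τ)
    (hRθ : (100 : ℝ) ^ θ ≤ 1 / R) {C : ℝ} (hC : C = 9248 * c)
    (hm1 : 2 + C ≤ m) (hm2 : 100 ≤ m) (hm3 : 20808 * c * Real.exp C ≤ m)
    (hN1 : 16 * θ * m / R ≤ N) (hN2 : N ≤ 17 * θ * m / R) (hℓt : 2 * N * ℓ = t) :
    16 / (R * N) * ((1 + 32 * c * ((2 : ℝ) ^ θ * τ) / ℓ) ^ N
        * (2 * Real.exp (-(R * N / 8)) + 6 * N ^ 2 * (c * Real.exp (-(θ * (ℓ / τ) ^ (1 / θ))))))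
      ≤ Real.exp (-(θ * m)) := by
  have hC0 : 0 < C := by rw [hC]; positivity
  have hm0 : 0 < m := by linarith
  have hθ0 : 0 < θ := by linarith
  have hθm : m ≤ θ * m := le_mul_of_one_le_left hm0.le hθ
  have hN0 : (0 : ℝ) < N := lt_of_lt_of_le (by positivity) hN1
  have ht : 0 < t := by
    have : 0 < R ^ 2 * t := by rw [hRt]; positivity
    exact (mul_pos_iff_of_pos_left (by positivity)).mp this
  have hℓ : ℓ = t / (2 * N) := by rw [← hℓt]; field_simp
  have hℓ0 : 0 < ℓ := by rw [hℓ]; positivity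
  have hmθ : m ^ (1 + θ) = m * m ^ θ := by rw [Real.rpow_add hm0, Real.rpow_one]
  have hRN : 16 * θ * m ≤ R * N := by
    rw [div_le_iff₀ hR] at hN1
    linarith
  have hpre : 16 / (R * N) ≤ 1 := by
    rw [div_le_one (by positivity)]
    nlinarith
  have hG : (1 + 32 * c * ((2 : ℝ) ^ θ * τ) / ℓ) ^ N ≤ Real.exp C := by
    refine (one_add_pow_le_exp_mul (by positivity) N).trans (Real.exp_le_exp.mpr ?_)
    have e1 : N * (32 * c * ((2 : ℝ) ^ θ * τ) / ℓ)
        = (R * N) ^ 2 * (16 * c * 2 ^ θ / (m * m ^ θ)) := by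
      have : t = 4 * (m * m ^ θ) * τ / R ^ 2 := by
        rw [eq_div_iff (by positivity), ← hmθ, ← hRt]; ring
      rw [hℓ, this]
      field_simp
      ring
    have e2 : R * N ≤ 17 * θ * m := by
      rw [le_div_iff₀ hR] at hN2
      linarith
    -- The `θ²` from `N² ≈ (θm/R)²` is harmless: `θ ≤ e^{θ-1}`, hence `θ² ≤ (e²)^{θ-1} ≤
    -- (m/2)^{θ-1}`.
    have e3 : θ ^ 2 * (2 / m) ^ θ * m ≤ 2 := by
      have h3 : θ ≤ Real.exp (θ - 1) := by linarith [Real.add_one_le_exp (θ - 1)]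
      have h4 : Real.exp 2 ≤ m / 2 := by
        have : Real.exp 1 ≤ 3 := by linarith [Real.exp_one_lt_d9]
        have h5 : Real.exp 2 = Real.exp 1 ^ 2 := by rw [← Real.exp_nat_mul]; norm_num
        rw [h5]
        calc Real.exp 1 ^ 2 ≤ 3 ^ 2 := by gcongr
          _ ≤ m / 2 := by linarith
      have h6 : θ ^ 2 ≤ (m / 2) ^ (θ - 1) := by
        calc θ ^ 2 ≤ Real.exp (θ - 1) ^ 2 := by gcongr
          _ = Real.exp 2 ^ (θ - 1) := by
            rw [← Real.exp_nat_mul, ← Real.exp_mul]; norm_num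
          _ ≤ _ := Real.rpow_le_rpow (Real.exp_pos _).le h4 (by linarith)
      have h7 : (2 / m) ^ θ * m = 2 * ((m / 2) ^ (θ - 1))⁻¹ := by
        rw [← Real.inv_rpow (by positivity), inv_div, Real.rpow_sub_one (by positivity)]
        field_simp
      rw [mul_assoc, h7]
      have h8 : 0 < (m / 2) ^ (θ - 1) := by positivity
      calc θ ^ 2 * (2 * ((m / 2) ^ (θ - 1))⁻¹)
          ≤ (m / 2) ^ (θ - 1) * (2 * ((m / 2) ^ (θ - 1))⁻¹) := by gcongr
        _ = 2 := by field_simp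
    rw [e1, hC]
    calc (R * N) ^ 2 * (16 * c * 2 ^ θ / (m * m ^ θ))
        ≤ (17 * θ * m) ^ 2 * (16 * c * 2 ^ θ / (m * m ^ θ)) := by gcongr
      _ = 4624 * c * (θ ^ 2 * (2 / m) ^ θ * m) := by
          rw [Real.div_rpow zero_le_two hm0.le]; field_simp; ring
      _ ≤ 4624 * c * 2 := by gcongr
      _ = _ := by ring
  have h1 : Real.exp C * (2 * Real.exp (-(R * N / 8))) ≤ Real.exp (-(θ * m)) / 2 := by
    have e1 : (4 : ℝ) ≤ Real.exp 2 := by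
      have : (2 : ℝ) ≤ Real.exp 1 := by linarith [Real.exp_one_gt_d9]
      have h5 : Real.exp 2 = Real.exp 1 ^ 2 := by rw [← Real.exp_nat_mul]; norm_num
      rw [h5]
      calc (4 : ℝ) = 2 ^ 2 := by norm_num
        _ ≤ _ := by gcongr
    calc Real.exp C * (2 * Real.exp (-(R * N / 8)))
        = 4 * Real.exp C * Real.exp (-(R * N / 8)) / 2 := by ring
      _ ≤ Real.exp 2 * Real.exp C * Real.exp (-(R * N / 8)) / 2 := by gcongr
      _ = Real.exp (2 + C + -(R * N / 8)) / 2 := by rw [← Real.exp_add, ← Real.exp_add]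
      _ ≤ _ := by gcongr; linarith
  have h2 : Real.exp C * (6 * N ^ 2 * (c * Real.exp (-(θ * (ℓ / τ) ^ (1 / θ)))))
      ≤ Real.exp (-(θ * m)) / 2 := by
    set ρ := (1 / R) ^ (1 / θ) with hρ
    have hρ0 : 0 < ρ := by positivity
    have hρR : ρ ^ θ = 1 / R := by
      rw [hρ, ← Real.rpow_mul (by positivity), one_div_mul_cancel hθ0.ne', Real.rpow_one]
    have hρ100 : 100 ≤ ρ := by
      have h3 := Real.rpow_le_rpow (by positivity) hRθ (show 0 ≤ 1 / θ by positivity)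
      rwa [← Real.rpow_mul (by norm_num), mul_one_div_cancel hθ0.ne', Real.rpow_one] at h3
    have e1 : m ^ θ * τ / (9 * R * θ) ≤ ℓ := by
      have h3 : ℓ = 2 * (m * m ^ θ) * τ / (R * (R * N)) := by
        have : t = 4 * (m * m ^ θ) * τ / R ^ 2 := by
          rw [eq_div_iff (by positivity), ← hmθ, ← hRt]; ring
        rw [hℓ, this]; field_simp; ring
      have h4 : R * N ≤ 17 * θ * m := by
        rw [le_div_iff₀ hR] at hN2
        linarith
      rw [h3, div_le_div_iff₀ (by positivity) (by positivity)]
      have h5 := mul_le_mul_of_nonneg_left h4 (show 0 ≤ m ^ θ * τ * R by positivity)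
      have h6 : 0 ≤ m ^ θ * τ * R * (θ * m) := by positivity
      linarith
    have e2 := exp_neg_mul_rpow_le_of_div hθ hτ hm0 hR hρ0 hρR e1
    -- Half of the exponent `θmρ/25` pays for `1/R² = ρ^{2θ}`; as `ρ ≥ 100`, the other half is still
    -- at least `2θm`.
    have e3 : (1 / R) ^ 2 ≤ Real.exp (θ * m * ρ / 50) := by
      rw [← hρR]
      have h3 : ρ ≤ Real.exp ρ := by linarith [Real.add_one_le_exp ρ]
      calc (ρ ^ θ) ^ 2 ≤ (Real.exp ρ ^ θ) ^ 2 := by gcongr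
        _ = Real.exp (2 * (ρ * θ)) := by
          rw [← Real.exp_mul, ← Real.exp_nat_mul]; norm_num
        _ ≤ _ := by
          refine Real.exp_le_exp.mpr ?_
          have := mul_le_mul_of_nonneg_left hm2 (show 0 ≤ ρ * θ by positivity)
          linarith
    have e4 : (θ * m) ^ 2 ≤ 6 / m * Real.exp (θ * m) := by
      have h3 := Real.pow_div_factorial_le_exp (θ * m) (by positivity) 3
      have h4 : (θ * m) ^ 3 ≤ 6 * Real.exp (θ * m) := by
        norm_num [Nat.factorial] at h3
        linarith
      rw [div_mul_eq_mul_div, le_div_iff₀ hm0]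
      calc (θ * m) ^ 2 * m ≤ (θ * m) ^ 2 * (θ * m) := by gcongr
        _ = (θ * m) ^ 3 := by ring
        _ ≤ _ := h4
    have e5 : Real.exp (θ * m * ρ / 50) * Real.exp (-(θ * m * ρ / 25)) ≤ Real.exp (-(2 * (θ * m))) := by
      rw [← Real.exp_add]
      refine Real.exp_le_exp.mpr ?_
      have := mul_le_mul_of_nonneg_left hρ100 (show 0 ≤ θ * m by positivity)
      linarith
    calc Real.exp C * (6 * N ^ 2 * (c * Real.exp (-(θ * (ℓ / τ) ^ (1 / θ)))))
        ≤ Real.exp C * (6 * (17 * θ * m / R) ^ 2 * (c * Real.exp (-(θ * m * ρ / 25)))) := by gcongr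
      _ = 1734 * c * Real.exp C * ((θ * m) ^ 2 * ((1 / R) ^ 2 * Real.exp (-(θ * m * ρ / 25)))) := by
          ring
      _ ≤ 1734 * c * Real.exp C * (6 / m * Real.exp (θ * m)
            * (Real.exp (θ * m * ρ / 50) * Real.exp (-(θ * m * ρ / 25)))) := by gcongr
      _ ≤ 1734 * c * Real.exp C * (6 / m * Real.exp (θ * m) * Real.exp (-(2 * (θ * m)))) := by
          gcongr
      _ = 20808 * c * Real.exp C / m * (Real.exp (θ * m) * Real.exp (-(2 * (θ * m))) / 2) := by
          ring
      _ = 20808 * c * Real.exp C / m * (Real.exp (-(θ * m)) / 2) := by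
          rw [← Real.exp_add]; congr 3; ring
      _ ≤ 1 * (Real.exp (-(θ * m)) / 2) := by
          gcongr
          exact (div_le_one hm0).mpr hm3
      _ = _ := one_mul _
  have hα : 0 < Real.exp (-(θ * (ℓ / τ) ^ (1 / θ))) := Real.exp_pos _
  calc _ ≤ 1 * (Real.exp C * (2 * Real.exp (-(R * N / 8))
        + 6 * N ^ 2 * (c * Real.exp (-(θ * (ℓ / τ) ^ (1 / θ)))))) := by gcongr
    _ ≤ _ := by linarith

/-! ### Reparametrisation by `θ`, `τ` and `m`, and the choice of the threshold. -/

/-- The time scale `τ = (θ/c')^θ` absorbs `c'` and puts `θ` in front of the exponent, so that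
exponentials of it become `θ`-th powers of `θ`-free quantities. -/
theorem mul_rpow_eq_mul_div_rpow {θ c' s : ℝ} (hθ : 0 < θ) (hc' : 0 < c') (hs : 0 ≤ s) :
    c' * s ^ (1 / θ) = θ * (s / (θ / c') ^ θ) ^ (1 / θ) := by
  rw [Real.div_rpow hs (by positivity), ← Real.rpow_mul (by positivity),
    mul_one_div_cancel hθ.ne', Real.rpow_one]
  field_simp

/-- The deviation `y = R √t` in terms of the effective number `m` of independent blocks. -/
theorem exists_effective_number {p c' y k : ℝ} (hp : 0 < p) (hp1 : p ≤ 1) (hc' : 0 < c')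
    (hy : 0 ≤ y) (hk : 0 ≤ k)
    (h : 2 * k ^ (1 / p) * ((2 - p) / (p * c')) ^ ((2 - p) / (2 * p)) ≤ y) :
    ∃ m, k ≤ m ∧
      y ^ 2 = 4 * m ^ (1 + (2 - p) / p) * ((2 - p) / p / c') ^ ((2 - p) / p) ∧
      (2 - p) / p * (1 / 2) ^ p * (p * c' / (2 - p)) ^ ((2 - p) / 2) * y ^ p
        = (2 - p) / p * m := by
  have h2p : 0 < 2 - p := by linarith
  set u := (2 - p) / (p * c') with hu
  have hu0 : 0 < u := by positivity
  have hu1 : (2 - p) / p / c' = u := by rw [hu, div_div]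
  have hu2 : p * c' / (2 - p) = u⁻¹ := by rw [hu, inv_div]
  set κ := u ^ ((2 - p) / (2 * p)) with hκ
  have hκ0 : 0 < κ := by positivity
  have hκ2 : κ ^ 2 = u ^ ((2 - p) / p) := by
    rw [hκ, ← Real.rpow_natCast, ← Real.rpow_mul hu0.le]
    congr 1; push_cast; field_simp
  have hκp : κ ^ p = u ^ ((2 - p) / 2) := by
    rw [hκ, ← Real.rpow_mul hu0.le]
    congr 1; field_simp
  -- This `m` solves `y² = 4 m^{1+θ} τ`, because `κ² = τ` and `p(1 + θ) = 2`.
  refine ⟨(y / 2 / κ) ^ p, ?_, ?_, ?_⟩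
  · calc k = (k ^ (1 / p)) ^ p := by
          rw [← Real.rpow_mul hk, one_div_mul_cancel hp.ne', Real.rpow_one]
      _ ≤ (y / 2 / κ) ^ p := by
          refine Real.rpow_le_rpow (by positivity) ?_ hp.le
          rw [div_div, le_div_iff₀ (by positivity)]
          linarith
  · rw [hu1, ← hκ2, ← Real.rpow_mul (by positivity),
      show p * (1 + (2 - p) / p) = (2 : ℕ) by push_cast; field_simp; ring, Real.rpow_natCast]
    field_simp
    norm_num
  · rw [hu2, Real.inv_rpow hu0.le, ← hκp, div_div, Real.div_rpow hy (by positivity),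
      Real.mul_rpow zero_le_two hκ0.le, Real.div_rpow zero_le_one zero_le_two, Real.one_rpow]
    field_simp

theorem exists_nat_between {x y : ℝ} (hx : 0 ≤ x) (h : x + 1 ≤ y) :
    ∃ N : ℕ, x ≤ N ∧ (N : ℝ) ≤ y :=
  ⟨⌈x⌉₊, Nat.le_ceil x, (Nat.ceil_lt_add_one hx).le.trans h⟩

/-- The number of effective blocks from which on the deviation bound holds. -/
noncomputable def blockThreshold (c : ℝ) : ℝ :=
  108 + 20480000 * c * Real.exp 32 + 20000 * Real.exp 32
    + 288 * c * Real.exp (20480000 * c * Real.exp 32)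
    + 9248 * c + 20808 * c * Real.exp (9248 * c)

/-! ### The deviation bound. -/

namespace MarkovProcess

variable {E Ω : Type*} [MeasurableSpace E] [MeasurableSpace Ω]

/-- Stretched exponential deviation bound for centred observables. -/
theorem IsMixing.measureReal_integral_le_exp {M : MarkovProcess E Ω} {μ : Measure E}
    [IsProbabilityMeasure μ] (hμ : M.IsInvariant μ) {c θ τ : ℝ} (hc : 0 < c) (hθ : 1 ≤ θ)
    (hτ : 0 < τ)
    (hα : M.IsMixing μ fun s => c * Real.exp (-(θ * ((s : ℝ) / τ) ^ (1 / θ))))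
    {f : E → ℝ} (hf : Measurable f) (hK : ∀ x, |f x| ≤ 2) (hf0 : ∫ x, f x ∂μ = 0)
    {R t m : ℝ} (hR : 0 < R) (hR1 : R ≤ 1) (hRt : R ^ 2 * t = 4 * m ^ (1 + θ) * τ)
    (hm : blockThreshold c ≤ m) :
    (M.law μ).real {ω | R * t ≤ ∫ s in (0 : ℝ)..t, f (M.X s.toNNReal ω)}
      ≤ Real.exp (-(θ * m)) := by
  have hα0 : ∀ s : ℝ≥0, 0 ≤ c * Real.exp (-(θ * ((s : ℝ) / τ) ^ (1 / θ))) := fun s => by positivity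
  have hαa : ∀ s : ℝ≥0, c * Real.exp (-(θ * ((s : ℝ) / τ) ^ (1 / θ)))
      ≤ c * (4 * ((2 : ℝ) ^ θ * τ) ^ 2 / ((2 : ℝ) ^ θ * τ + s) ^ 2) := fun s =>
    mul_le_mul_of_nonneg_left (exp_neg_mul_rpow_le hθ hτ s.2) hc.le
  -- All summands are positive, so `m` exceeds each of the lower bounds required in the two regimes.
  unfold blockThreshold at hm
  have p1 : 0 < 20480000 * c * Real.exp 32 := by positivity
  have p2 : 0 < 20000 * Real.exp 32 := by positivity
  have p3 : 0 < 288 * c * Real.exp (20480000 * c * Real.exp 32) := by positivity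
  have p4 : 0 < 9248 * c := by positivity
  have p5 : 0 < 20808 * c * Real.exp (9248 * c) := by positivity
  have hm0 : 0 < m := by linarith
  have ht : 0 < t := by
    have : 0 < R ^ 2 * t := by rw [hRt]; positivity
    exact (mul_pos_iff_of_pos_left (by positivity)).mp this
  have hmR : m ≤ m / R := (le_div_iff₀ hR).mpr (mul_le_of_le_one_right hm0.le hR1)
  have hlen : ∀ N : ℕ, 1 ≤ N → ∃ ℓ : ℝ≥0, 0 < ℓ ∧ 2 * N * (ℓ : ℝ) = t := fun N hN => by
    have hN0 : (0 : ℝ) < N := by exact_mod_cast hN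
    refine ⟨(t / (2 * N)).toNNReal, Real.toNNReal_pos.mpr (by positivity), ?_⟩
    rw [Real.coe_toNNReal _ (by positivity)]
    field_simp
  -- For `R ≥ 100^{-θ}` the blocks must be long, so there are too few for the exponential moment to
  -- reach `θm`, and heavy weights on a count are used. For smaller `R` the rate at the shorter
  -- length is small enough.
  rcases le_total (1 / R) ((100 : ℝ) ^ θ) with h | h
  · obtain ⟨N, hN1, hN2⟩ := exists_nat_between (x := m / (2 * R)) (y := m / R) (by positivity) (by
      rw [show m / (2 * R) = m / R / 2 by field_simp]
      linarith)
    have hN : 1 ≤ N := by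
      have : (0 : ℝ) < N := lt_of_lt_of_le (by positivity) hN1
      exact_mod_cast this
    obtain ⟨ℓ, hℓ, hℓt⟩ := hlen N hN
    exact (M.measureReal_integral_le_of_count hμ hα hα0 hc.le (by positivity) hαa hf hK hf0 hR
      (by positivity : 0 < 32 * θ) hN hℓ hℓt).trans
      (count_bound_le hc hθ hτ hR hR1 hRt h rfl (by linarith) (by linarith) (by linarith) hN1 hN2
        hℓt)
  · have hθm : 1 ≤ θ * m / R := by
      have : m / R ≤ θ * m / R := by
        gcongr
        exact le_mul_of_one_le_left hm0.le hθ
      linarith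
    obtain ⟨N, hN1, hN2⟩ := exists_nat_between (x := 16 * θ * m / R) (y := 17 * θ * m / R)
      (by positivity) (by
        have e1 : 16 * θ * m / R = 16 * (θ * m / R) := by ring
        have e2 : 17 * θ * m / R = 17 * (θ * m / R) := by ring
        linarith)
    have hN : 1 ≤ N := by
      have : (0 : ℝ) < N := lt_of_lt_of_le (by positivity) hN1
      exact_mod_cast this
    obtain ⟨ℓ, hℓ, hℓt⟩ := hlen N hN
    exact (M.measureReal_integral_le_of_exp hμ hα hα0 hc.le (by positivity) hαa hf hK hf0 hR
      hN hℓ hℓt).trans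
      (exp_bound_le hc hθ hτ hR hRt h rfl (by linarith) (by linarith) (by linarith) hN1 hN2 hℓt)

end MarkovProcess

theorem mainTheorem7 (c : ℝ) (hc : 0 < c) :
    ∃ k₀ : ℝ, 0 < k₀ ∧
      ∀ (p c' : ℝ), 0 < p → p ≤ 1 → 0 < c' →
      ∀ (E Ω : Type*) [TopologicalSpace E] [PolishSpace E] [MeasurableSpace E] [BorelSpace E]
        [MeasurableSpace Ω] (M : MarkovProcess E Ω) (μ : Measure E) [IsProbabilityMeasure μ],
      M.IsInvariant μ →
      M.DecayWithRate μ (fun s => c * Real.exp (-c' * (s : ℝ) ^ (p / (2 - p)))) →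
      ∀ V : E → ℝ, Measurable V → IsLUB (Set.range fun x => |V x|) 1 →
      ∀ R t : ℝ, 0 < R → R ≤ 1 → 0 < t → t * (1 - R) < (⌊t⌋ : ℝ) →
        2 * k₀ ^ (1 / p) * ((2 - p) / (p * c')) ^ ((2 - p) / (2 * p))
          ≤ (R - (1 - (⌊t⌋ : ℝ) / t)) * √t →
        (M.law μ).real
            {ω | R ≤ (1 / t) * (∫ s in (0 : ℝ)..t, V (M.X s.toNNReal ω)) - ∫ x, V x ∂μ}
          ≤ Real.exp (-((2 - p) / p * (1 / 2) ^ p * (p * c' / (2 - p)) ^ ((2 - p) / 2))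
              * ((R - (1 - (⌊t⌋ : ℝ) / t)) * √t) ^ p) := by
  have hk0 : 0 < blockThreshold c := by unfold blockThreshold; positivity
  refine ⟨blockThreshold c, hk0, ?_⟩
  intro p c' hp hp1 hc' E Ω _ _ _ _ _ M μ _ hμ hdecay V hV hV1 R t hR hR1 ht hRt hcond
  have h2p : 0 < 2 - p := by linarith
  set R' := R - (1 - (⌊t⌋ : ℝ) / t) with hR'
  have hfl : (⌊t⌋ : ℝ) / t ≤ 1 := (div_le_one ht).mpr (Int.floor_le t)
  have hR'0 : 0 < R' := by
    have : 1 - R < (⌊t⌋ : ℝ) / t := by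
      rw [lt_div_iff₀ ht]
      linarith
    rw [hR']
    linarith
  have hR'R : R' ≤ R := by rw [hR']; linarith
  obtain ⟨m, hm, hym, hexp⟩ := exists_effective_number hp hp1 hc'
    (by positivity : 0 ≤ R' * √t) hk0.le hcond
  set θ := (2 - p) / p with hθ
  have hθ1 : 1 ≤ θ := by rw [hθ, one_le_div hp]; linarith
  have hpθ : p / (2 - p) = 1 / θ := by rw [hθ, one_div_div]
  have hrate : (fun s : ℝ≥0 => c * Real.exp (-c' * (s : ℝ) ^ (p / (2 - p))))
      = fun s : ℝ≥0 => c * Real.exp (-(θ * ((s : ℝ) / (θ / c') ^ θ) ^ (1 / θ))) := by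
    funext s
    rw [hpθ, neg_mul, mul_rpow_eq_mul_div_rpow (by positivity) hc' s.coe_nonneg]
  rw [hrate] at hdecay
  have hmix := hdecay.isMixing hμ fun s => by positivity
  have hVb : ∀ x, |V x| ≤ 1 := fun x => hV1.1 ⟨x, rfl⟩
  have hVi : Integrable V μ := integrable_of_forall_abs_le hV hVb
  set v := ∫ x, V x ∂μ with hv
  have hvb : |v| ≤ 1 := abs_integral_le_of_forall_abs_le hVb
  -- Centring `V` doubles its bound, whence the constant `2` for observables; the event is enlarged
  -- by passing from `R` to `R' ≤ R`.
  have hmain := hmix.measureReal_integral_le_exp hμ hc hθ1 (by positivity)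
    (hV.sub_const v) (fun x => (abs_sub _ _).trans (by linarith [hVb x]))
    (by rw [integral_sub hVi (integrable_const _), integral_const]; simp [hv])
    hR'0 (hR'R.trans hR1) (m := m) (t := t)
    (by rw [← hym, mul_pow, Real.sq_sqrt ht.le]) hm
  rw [neg_mul, hexp]
  refine (measureReal_mono ?_).trans hmain
  intro ω hω
  simp only [Set.mem_ofPred_eq] at hω ⊢
  rw [intervalIntegral.integral_sub (M.intervalIntegrable_path hV hVb ω _ _)
    intervalIntegrable_const, intervalIntegral.integral_const, smul_eq_mul, sub_zero]
  have h1 := mul_le_mul_of_nonneg_right (hR'R.trans hω) ht.le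
  refine h1.trans (le_of_eq ?_)
  field_simp
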